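/- We work in the deterministic $\mathsf{LOCAL}$ model: every vertex of an $n$-vertex graph $G$ carries a distinct identifier in $\{1,\dots,n\}$; initially it knows only $n$, its own identifier and its own input; in each synchronous round it exchanges messages of unbounded size with its neighbors and then performs an arbitrary local computation; at some point it irrevocably chooses an output, after which it may still forward messages. The round complexity is the number of rounds until every vertex has chosen its output. Let $d(v)$ denote the degree and $N(v)$ the neighborhood of $v$ in $G$. A list-assignment $L$ (a finite set $L(v)$ of colors for each vertex $v$) is called nice if $|L(v)|\ge d(v)$ for every vertex $v$, and $|L(v)|\ge d(v)+1$ for every vertex $v$ such that $d(v)\le 2$ or $N(v)$ is a clique. Theorem. There is a deterministic distributed algorithm in the $\mathsf{LOCAL}$ model that, given any finite graph $G$ with $n$ vertices and maximum degree $\Delta$ and any nice list-assignment $L$ of $G$ (the input of $v$ being the list $L(v)$), finds an $L$-list-coloring of $G$, that is, each vertex $v$ outputs a color $c(v)\in L(v)$ and $c(u)\ne c(v)$ for all adjacent $u,v$, within $O(\Delta^2\log^3 n)$ rounds. More precisely, there is an absolute constant $C$, independent of the graph, the identifiers, the lists and the set of colors, such that every vertex chooses its color within $C\max(\Delta,1)^2\log^3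 n$ rounds. -/

import Mathlib

/-- A deterministic algorithm of the LOCAL model, for nodes with local inputs in `I` and outputs
in `O`. States, messages and the transition functions are arbitrary (messages of unbounded size,
nodes of infinite computational power). All nodes run the same algorithm.

In every synchronous round each node sends one message to all its neighbors and updates its state
from the family of messages it receives. Messages can contain the identifiers of
their sender and of their addressees, so individually addressed messages can be simulated in the
same number of rounds. -/
structure LocalAlgorithm (I O : Type) where
  /-- Internal states of a node. -/
  State : Type
  /-- Messages. -/
  Msg : Type
  /-- Initial state of a node, computed from the number `n` of vertices of the network, the
  identifier of the node and its local input, and from nothing else. -/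
  init : (n : ℕ) → (ident : ℕ) → (input : I) → State
  /-- The message sent to the neighbors. -/
  send : State → Msg
  /-- The new state, from the old state and the messages received from the neighbors. -/
  receive : State → Multiset Msg → State
  /-- The output shown in a given state, if any. -/
  output : State → Option O

namespace LocalAlgorithm

variable {I O V : Type}

/-- The state of the node `v` after `t` rounds of `A` in the network `G`. -/
def state (A : LocalAlgorithm I O) [Fintype V] (G : SimpleGraph V) [DecidableRel G.Adj]
    (ident : V → ℕ) (input : V → I) : ℕ → V → A.State
  | 0, v => A.init (Fintype.card V) (ident v) (input v)
  | t + 1, v =>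
      A.receive (A.state G ident input t v)
        ((G.neighborFinset v).val.map fun w => A.send (A.state G ident input t w))

/-- The node `v` chooses the output `o` after exactly `t` rounds: `o` is the first output that it
shows, so that the choice is irrevocable. The node may still pass on messages afterwards. -/
def Chooses (A : LocalAlgorithm I O) [Fintype V] (G : SimpleGraph V) [DecidableRel G.Adj]
    (ident : V → ℕ) (input : V → I) (v : V) (t : ℕ) (o : O) : Prop :=
  A.output (A.state G ident input t v) = some o ∧
    ∀ s < t, A.output (A.state G ident input s v) = none

end LocalAlgorithm

/-- The identifiers of the nodes: distinct integers between `1` and the number of vertices. -/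
def IsIdentifierAssignment {V : Type} [Fintype V] (ident : V → ℕ) : Prop :=
  Function.Injective ident ∧ ∀ v, 1 ≤ ident v ∧ ident v ≤ Fintype.card V

/-- A list-assignment is nice if every vertex `v` has at least `d(v)` colors in its list, and at
least `d(v) + 1` colors if `d(v) ≤ 2` or the neighbors of `v` form a clique. -/
def IsNiceListAssignment {V κ : Type} [Fintype V] (G : SimpleGraph V) [DecidableRel G.Adj]
    (L : V → Finset κ) : Prop :=
  ∀ v, G.degree v ≤ (L v).card ∧
    (G.degree v ≤ 2 ∨ G.IsClique (G.neighborSet v) → G.degree v + 1 ≤ (L v).card)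

/-!
# Coloring from nice list-assignments in the `LOCAL` model

*Reduction to local functions.* Only the amount of information that a node can collect matters: in
`gather` the nodes spread everything they know, and a node chooses an output once all networks that
are consistent with its knowledge lead to the same one. So it suffices to define a coloring of all
networks on the vertex set `Fin n` whose value at a vertex is determined by the ball of some radius
(`LocalAt`, `Agree`). The nodes do not know the maximum degree `Δ`; accordingly, the radius may be
computed from the maximum degree of the actual network, while the networks that agree with it on the
ball are arbitrary.

*Flexible sets.* A set `B` of vertices is flexible if every coloring of the other vertices extends to
`B`. Single vertices with more colors than neighbors are flexible, and so are two-connected sets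
that are not regular, or regular of degree `k` and `k`-colorable
(`TwoConnOn.regular_of_not_degreeChoosable`). Every ball of radius `2 * m + 1`, where `2 ^ m`
exceeds the number of vertices, contains a flexible set
(`Network.IsNice.exists_flexible`). Otherwise all vertices of the ball have at least three neighbors,
not all adjacent, and the cycles formed by breadth-first search show that vertices have a unique
parent and at least two grandchildren; then the levels grow exponentially
(`RegularBall.two_pow_le`).

*The coloring.* The bits of the identifiers give a ruling set, whose vertices have pairwise distance
larger than `4 * m + 3`, such that all vertices are within distance `O(m ^ 2)` of it (`Ruling`). The
flexible sets around the vertices of the ruling set are disjoint and without edges between them. The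
other vertices are colored greedily, those far from the flexible sets first: when a vertex is
colored, its next neighbor on the way to a flexible set is still uncolored, so that a color is left.
Ties between vertices of the same distance are broken by a proper coloring with values at most
`Δ`, itself obtained from the bits of the identifiers (`bitColor`). So the chains of dependent
choices have length `O(Δ * m ^ 2)`, which bounds the radius (`greedy_congr`). At last the coloring is
extended to the flexible sets.
-/

/-! ### Colorings from lists on connected vertex sets -/

section Choosability

variable {V κ : Type*}

open Classical in
/-- The number of neighbors of `u` in the vertex set `B`. -/
noncomputable def degIn (G : SimpleGraph V) (B : Finset V) (u : V) : ℕ :=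
  (B.filter fun w => G.Adj u w).card

/-- The subgraph of `G` induced by `B` has a proper coloring from the lists `L`. -/
def ColorableOn (G : SimpleGraph V) (B : Finset V) (L : V → Finset κ) : Prop :=
  ∃ c : V → κ, (∀ u ∈ B, c u ∈ L u) ∧ ∀ u ∈ B, ∀ w ∈ B, G.Adj u w → c u ≠ c w

/-- The subgraph of `G` induced by `B` is connected or empty, expressed by cuts: a set that meets
`B` and is closed under adjacency inside `B` contains `B`. -/
def ConnOn (G : SimpleGraph V) (B : Finset V) : Prop :=
  ∀ T : Set V, ∀ t ∈ B, t ∈ T → (∀ x ∈ B, x ∈ T → ∀ y ∈ B, G.Adj x y → y ∈ T) → ∀ y ∈ B, y ∈ T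

/-- The subgraph of `G` induced by `B` is connected and has no cut vertex. -/
def TwoConnOn [DecidableEq V] (G : SimpleGraph V) (B : Finset V) : Prop :=
  ConnOn G B ∧ ∀ x ∈ B, ConnOn G (B.erase x)

/-- The subgraph of `G` induced by `B` can be colored from all lists, with colors in `κ`, that have
at least as many colors as the degrees in this subgraph. -/
def DegreeChoosable (κ : Type*) (G : SimpleGraph V) (B : Finset V) : Prop :=
  ∀ L : V → Finset κ, (∀ u ∈ B, degIn G B u ≤ (L u).card) → ColorableOn G B L

theorem degIn_insert [DecidableEq V] (G : SimpleGraph V) [DecidableRel G.Adj] {B : Finset V}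
    {x : V} (hx : x ∉ B) (y : V) :
    degIn G (insert x B) y = degIn G B y + if G.Adj y x then 1 else 0 := by
  classical
  unfold degIn
  rw [Finset.filter_insert]
  split_ifs with h
  · rw [Finset.card_insert_of_notMem (by simp [hx])]
  · rfl

theorem three_le_degIn {G : SimpleGraph V} {B : Finset V} {u x y z : V}
    (hx : x ∈ B) (hy : y ∈ B) (hz : z ∈ B) (ux : G.Adj u x) (uy : G.Adj u y) (uz : G.Adj u z)
    (xy : x ≠ y) (xz : x ≠ z) (yz : y ≠ z) : 3 ≤ degIn G B u := by
  classical
  rw [← Finset.card_eq_three.2 ⟨x, y, z, xy, xz, yz, rfl⟩]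
  refine Finset.card_le_card fun w hw => ?_
  simp only [Finset.mem_insert, Finset.mem_singleton] at hw
  rcases hw with rfl | rfl | rfl <;> simp [*]

theorem degIn_le_two {G : SimpleGraph V} {B : Finset V} {u x y : V}
    (h : ∀ w ∈ B, G.Adj u w → w = x ∨ w = y) : degIn G B u ≤ 2 := by
  classical
  refine le_trans (Finset.card_le_card (t := {x, y}) fun w hw => ?_) Finset.card_le_two
  simpa using h w (Finset.mem_filter.1 hw).1 (Finset.mem_filter.1 hw).2

theorem ColorableOn.insert [DecidableEq V] [DecidableEq κ] {G : SimpleGraph V} [DecidableRel G.Adj]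
    {B : Finset V} {L : V → Finset κ} {x : V} {α : κ} (hx : x ∉ B) (hα : α ∈ L x)
    (h : ColorableOn G B fun y => if G.Adj x y then (L y).erase α else L y) :
    ColorableOn G (insert x B) L := by
  obtain ⟨c, hc, hp⟩ := h
  have hne : ∀ y ∈ B, y ≠ x := fun y hy => by rintro rfl; exact hx hy
  have hadj : ∀ y ∈ B, G.Adj x y → c y ≠ α := fun y hy hxy => by
    have := hc y hy
    simp only [hxy, if_true] at this
    exact (Finset.mem_erase.1 this).1
  refine ⟨Function.update c x α, fun u hu => ?_, fun u hu w hw huw => ?_⟩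
  · rcases Finset.mem_insert.1 hu with rfl | hu
    · simpa using hα
    · rw [Function.update_of_ne (hne u hu)]
      have := hc u hu
      dsimp only at this
      split_ifs at this
      · exact Finset.mem_of_mem_erase this
      · exact this
  · rcases Finset.mem_insert.1 hu with rfl | hu' <;>
      rcases Finset.mem_insert.1 hw with rfl | hw'
    · exact (G.loopless.irrefl _ huw).elim
    · rw [Function.update_self, Function.update_of_ne (hne w hw')]
      exact (hadj w hw' huw).symm
    · rw [Function.update_self, Function.update_of_ne (hne u hu')]
      exact hadj u hu' huw.symm
    · rw [Function.update_of_ne (hne u hu'), Function.update_of_ne (hne w hw')]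
      exact hp u hu' w hw' huw

/-- When the color `α` of `x` is removed from the lists of its neighbors, the lists lose no more
than the degrees lose by the removal of `x`. -/
theorem degIn_add_le_card_erase [DecidableEq V] [DecidableEq κ] {G : SimpleGraph V}
    [DecidableRel G.Adj] {B : Finset V} {L : V → Finset κ} {x y : V} {j : ℕ} (α : κ) (hx : x ∉ B)
    (h : degIn G (insert x B) y + j ≤ (L y).card) :
    degIn G B y + j ≤ (if G.Adj x y then (L y).erase α else L y).card := by
  rw [degIn_insert G hx] at h
  have := Finset.pred_card_le_card_erase (s := L y) (a := α)
  by_cases hxy : G.Adj x y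
  · simp only [hxy, hxy.symm, if_true] at h ⊢
    omega
  · simp only [hxy, if_false]
    omega

/-- A connected set can be colored from lists that are as large as the degrees, if some vertex has
one color more than its degree: color towards this vertex. -/
theorem ConnOn.colorableOn {G : SimpleGraph V} {B : Finset V} (hB : ConnOn G B)
    {L : V → Finset κ} (hdeg : ∀ y ∈ B, degIn G B y ≤ (L y).card) {u : V} (hu : u ∈ B)
    (hlt : degIn G B u < (L u).card) : ColorableOn G B L := by
  classical
  let good : Finset V → Prop := fun T => u ∈ T ∧ ∀ M : V → Finset κ,
    (∀ y ∈ T, degIn G T y ≤ (M y).card) → degIn G T u < (M u).card → ColorableOn G T M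
  have hstart : good {u} := by
    refine ⟨by simp, fun M _ hM => ?_⟩
    obtain ⟨α, hα⟩ := Finset.card_pos.1 (lt_of_le_of_lt (Nat.zero_le _) hM)
    exact ⟨fun _ => α, by simpa using hα, by simp⟩
  have hstep : ∀ T, good T → ∀ x ∉ T, (∃ t ∈ T, G.Adj t x) → good (insert x T) := by
    rintro T ⟨huT, hT⟩ x hx ⟨t, ht, htx⟩
    refine ⟨Finset.mem_insert_of_mem huT, fun M hM hMu => ?_⟩
    have hpos : 0 < degIn G (insert x T) x :=
      Finset.card_pos.2 ⟨t, by simp [ht, htx.symm]⟩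
    obtain ⟨α, hα⟩ := Finset.card_pos.1 (hpos.trans_le (hM x (by simp)))
    refine ColorableOn.insert hx hα (hT _ (fun y hy => ?_) ?_)
    · exact degIn_add_le_card_erase (j := 0) α hx (hM y (Finset.mem_insert_of_mem hy))
    · exact degIn_add_le_card_erase (j := 1) α hx hMu
  obtain ⟨T, hT, hmax⟩ := Finset.exists_max_image (B.powerset.filter good) Finset.card
    ⟨{u}, by simp [hu, hstart]⟩
  rw [Finset.mem_filter, Finset.mem_powerset] at hT
  have hBT : B ⊆ T := hB (T : Set V) u hu hT.2.1 fun x _ hxT y hy hxy => by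
    by_contra hyT
    have hyT' : y ∉ T := hyT
    have := hmax (insert y T) (by
      rw [Finset.mem_filter, Finset.mem_powerset]
      exact ⟨Finset.insert_subset hy hT.1, hstep T hT.2 y hyT' ⟨x, hxT, hxy⟩⟩)
    rw [Finset.card_insert_of_notMem hyT'] at this
    omega
  obtain rfl := Finset.Subset.antisymm hBT hT.1
  exact hT.2.2 L hdeg hlt

/-- Two-connected case of the theorem of Erdős, Rubin and Taylor on degree-choosable graphs, with
Brooks' theorem left out: a two-connected graph that is not degree-choosable is `k`-regular for
some `k`, and has no proper coloring with `k` colors. If neighbors `x` and `u` have different lists,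
one of them, say `x`, can receive a color that is missing in the other list, and the remaining
connected graph is then colored towards `u`. So all lists are equal. -/
theorem TwoConnOn.regular_of_not_degreeChoosable [DecidableEq V] {G : SimpleGraph V}
    {B : Finset V} (hB : TwoConnOn G B) {z : V} (hz : z ∈ B)
    (hn : ¬ DegreeChoosable κ G B) :
    ∃ k, (∀ u ∈ B, degIn G B u = k) ∧
      ¬ ∃ f : V → ℕ, (∀ u ∈ B, f u < k) ∧ ∀ u ∈ B, ∀ w ∈ B, G.Adj u w → f u ≠ f w := by
  classical
  simp only [DegreeChoosable, not_forall] at hn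
  obtain ⟨L, hdeg, hcol⟩ := hn
  have hsub : ∀ x ∈ B, ∀ u ∈ B, G.Adj x u → L x ⊆ L u := by
    intro x hx u hu hxu α hα
    by_contra hαu
    apply hcol
    rw [← Finset.insert_erase hx] at hdeg ⊢
    have hxe := Finset.notMem_erase x B
    have hue : u ∈ B.erase x := Finset.mem_erase.2 ⟨hxu.ne', hu⟩
    refine ColorableOn.insert hxe hα ((hB.2 x hx).colorableOn (fun y hy => ?_) hue ?_)
    · exact degIn_add_le_card_erase (j := 0) α hxe (hdeg y (Finset.mem_insert_of_mem hy))
    · have := hdeg u (Finset.mem_insert_of_mem hue)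
      rw [degIn_insert G hxe, if_pos hxu.symm] at this
      rw [if_pos hxu, Finset.erase_eq_of_notMem hαu]
      omega
  have heq : ∀ y ∈ B, L y = L z :=
    hB.1 {y | L y = L z} z hz rfl fun x hx hxz y hy hxy =>
      ((hsub y hy x hx hxy.symm).antisymm (hsub x hx y hy hxy)).trans hxz
  refine ⟨(L z).card, fun u hu => ?_, ?_⟩
  · refine le_antisymm (by simpa [heq u hu] using hdeg u hu) (not_lt.1 fun hlt => ?_)
    exact hcol (hB.1.colorableOn hdeg hu (by rwa [heq u hu]))
  · rintro ⟨f, hf, hp⟩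
    have hpos : 0 < (L z).card := (Nat.zero_le _).trans_lt (hf z hz)
    let e := (L z).equivFin.symm
    refine hcol ⟨fun v => if h : f v < (L z).card then e ⟨f v, h⟩ else e ⟨0, hpos⟩,
      fun u hu => ?_, fun u hu w hw huw => ?_⟩
    · simp only [hf u hu, dif_pos, heq u hu]
      exact (e _).2
    · simp only [hf u hu, hf w hw, dif_pos]
      intro h
      have := e.injective (Subtype.ext h)
      simp only [Fin.mk.injEq] at this
      exact hp u hu w hw huw this

theorem connOn_singleton (G : SimpleGraph V) (x : V) : ConnOn G {x} := by
  intro T t ht htT _ y hy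
  rw [Finset.mem_singleton] at ht hy
  rwa [hy, ← ht]

theorem ConnOn.union [DecidableEq V] {G : SimpleGraph V} {A B : Finset V} (hA : ConnOn G A)
    (hB : ConnOn G B) {x y : V} (hx : x ∈ A) (hy : y ∈ B) (hxy : x = y ∨ G.Adj x y) :
    ConnOn G (A ∪ B) := by
  intro T t ht htT hcl
  have clA : ∀ x ∈ A, x ∈ T → ∀ y ∈ A, G.Adj x y → y ∈ T := fun x hx hxT y hy =>
    hcl x (Finset.mem_union_left _ hx) hxT y (Finset.mem_union_left _ hy)
  have clB : ∀ x ∈ B, x ∈ T → ∀ y ∈ B, G.Adj x y → y ∈ T := fun x hx hxT y hy =>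
    hcl x (Finset.mem_union_right _ hx) hxT y (Finset.mem_union_right _ hy)
  have key : (∀ z ∈ A, z ∈ T) ∧ ∀ z ∈ B, z ∈ T := by
    rcases Finset.mem_union.1 ht with h | h
    · have hAT := hA T t h htT clA
      refine ⟨hAT, hB T y hy ?_ clB⟩
      rcases hxy with rfl | hxy
      · exact hAT _ hx
      · exact hcl x (Finset.mem_union_left _ hx) (hAT x hx) y (Finset.mem_union_right _ hy) hxy
    · have hBT := hB T t h htT clB
      refine ⟨hA T x hx ?_ clA, hBT⟩
      rcases hxy with rfl | hxy
      · exact hBT _ hy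
      · exact hcl y (Finset.mem_union_right _ hy) (hBT y hy) x (Finset.mem_union_left _ hx)
          hxy.symm
  intro z hz
  exact (Finset.mem_union.1 hz).elim (key.1 z) (key.2 z)

theorem connOn_image_range [DecidableEq V] {G : SimpleGraph V} {f : ℕ → V} {k : ℕ}
    (hf : ∀ i, i + 1 < k → G.Adj (f i) (f (i + 1))) : ConnOn G ((Finset.range k).image f) := by
  induction k with
  | zero => intro T t ht; simp at ht
  | succ k ih =>
    rcases k with _ | k
    · simpa using connOn_singleton G (f 0)
    · rw [Finset.range_add_one, Finset.image_insert, Finset.insert_eq, Finset.union_comm]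
      exact (ih fun i hi => hf i (by omega)).union (connOn_singleton G _)
        (Finset.mem_image_of_mem f (Finset.mem_range.2 (Nat.lt_succ_self k)))
        (Finset.mem_singleton_self _) (Or.inr (hf k (by omega)))

/-- Two-connected sets that share two vertices have a two-connected union. -/
theorem TwoConnOn.union [DecidableEq V] {G : SimpleGraph V} {A B : Finset V}
    (hA : TwoConnOn G A) (hB : TwoConnOn G B) {x y : V} (hxy : x ≠ y) (hxA : x ∈ A) (hxB : x ∈ B)
    (hyA : y ∈ A) (hyB : y ∈ B) : TwoConnOn G (A ∪ B) := by
  have herase : ∀ {C : Finset V}, TwoConnOn G C → ∀ z, ConnOn G (C.erase z) := fun {C} hC z => by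
    by_cases hz : z ∈ C
    · exact hC.2 z hz
    · rw [Finset.erase_eq_of_notMem hz]
      exact hC.1
  refine ⟨hA.1.union hB.1 hxA hxB (Or.inl rfl), fun z _ => ?_⟩
  rw [Finset.erase_union_distrib]
  by_cases hz : z = x
  · subst hz
    exact (herase hA z).union (herase hB z) (Finset.mem_erase.2 ⟨hxy.symm, hyA⟩)
      (Finset.mem_erase.2 ⟨hxy.symm, hyB⟩) (Or.inl rfl)
  · exact (herase hA z).union (herase hB z) (Finset.mem_erase.2 ⟨Ne.symm hz, hxA⟩)
      (Finset.mem_erase.2 ⟨Ne.symm hz, hxB⟩) (Or.inl rfl)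

theorem TwoConnOn.insert [DecidableEq V] {G : SimpleGraph V} {A : Finset V}
    (hA : TwoConnOn G A) {x y z : V} (hxy : x ≠ y) (hx : x ∈ A) (hy : y ∈ A)
    (hzx : G.Adj z x) (hzy : G.Adj z y) : TwoConnOn G (insert z A) := by
  by_cases hzA : z ∈ A
  · rwa [Finset.insert_eq_of_mem hzA]
  rw [Finset.insert_eq]
  refine ⟨(connOn_singleton G z).union hA.1 (Finset.mem_singleton_self z) hx (Or.inr hzx),
    fun w hw => ?_⟩
  rw [← Finset.insert_eq] at hw ⊢
  rcases eq_or_ne w z with rfl | hwz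
  · rw [Finset.erase_insert hzA]
    exact hA.1
  have hwA := (Finset.mem_insert.1 hw).resolve_left hwz
  rw [Finset.erase_insert_of_ne hwz.symm, Finset.insert_eq]
  rcases eq_or_ne w x with rfl | hwx
  · exact (connOn_singleton G z).union (hA.2 w hwA) (Finset.mem_singleton_self z)
      (Finset.mem_erase.2 ⟨hxy.symm, hy⟩) (Or.inr hzy)
  · exact (connOn_singleton G z).union (hA.2 w hwA) (Finset.mem_singleton_self z)
      (Finset.mem_erase.2 ⟨hwx.symm, hx⟩) (Or.inr hzx)

/-- A cycle that is given as two paths with adjacent starts and a common end is two-connected. -/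
theorem twoConnOn_of_paths [DecidableEq V] {G : SimpleGraph V} {a b : ℕ → V} {k l : ℕ}
    (hk : 1 ≤ k) (hl : 1 ≤ l)
    (ha : ∀ i < k, G.Adj (a i) (a (i + 1))) (hb : ∀ i < l, G.Adj (b i) (b (i + 1)))
    (h0 : G.Adj (a 0) (b 0)) (hkl : a k = b l)
    (ia : ∀ i ≤ k, ∀ j ≤ k, a i = a j → i = j) (ib : ∀ i ≤ l, ∀ j ≤ l, b i = b j → i = j)
    (iab : ∀ i ≤ k, ∀ j ≤ l, a i = b j → i = k ∧ j = l) :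
    TwoConnOn G ((Finset.range (k + 1)).image a ∪ (Finset.range (l + 1)).image b) := by
  have conn : ∀ {f : ℕ → V} {m : ℕ}, (∀ i < m, G.Adj (f i) (f (i + 1))) → ∀ s j, s + j ≤ m + 1 →
      ConnOn G ((Finset.range j).image fun i => f (s + i)) := fun {f m} hf s j hj =>
    connOn_image_range fun i hi => hf (s + i) (by omega)
  -- the removal of a vertex of the first path other than its end
  have side : ∀ {a b : ℕ → V} {k l : ℕ}, (∀ i < k, G.Adj (a i) (a (i + 1))) →
      (∀ i < l, G.Adj (b i) (b (i + 1))) → G.Adj (a 0) (b 0) → a k = b l →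
      (∀ i ≤ k, ∀ j ≤ k, a i = a j → i = j) →
      (∀ i ≤ k, ∀ j ≤ l, a i = b j → i = k ∧ j = l) → ∀ i < k,
      ConnOn G (((Finset.range (k + 1)).image a ∪ (Finset.range (l + 1)).image b).erase (a i)) := by
    intro a b k l ha hb h0 hkl ia iab i hi
    have e : ((Finset.range (k + 1)).image a ∪ (Finset.range (l + 1)).image b).erase (a i) =
        (Finset.range i).image a ∪ ((Finset.range (l + 1)).image b ∪
          (Finset.range (k - i)).image fun j => a (i + 1 + j)) := by
      ext y
      simp only [Finset.mem_erase, Finset.mem_union, Finset.mem_image, Finset.mem_range]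
      constructor
      · rintro ⟨hy, ⟨j, hj, rfl⟩ | h⟩
        · rcases lt_trichotomy j i with h | rfl | h
          · exact Or.inl ⟨j, h, rfl⟩
          · exact (hy rfl).elim
          · exact Or.inr (Or.inr ⟨j - (i + 1), by omega, by congr 1; omega⟩)
        · exact Or.inr (Or.inl h)
      · rintro (⟨j, hj, rfl⟩ | ⟨j, hj, rfl⟩ | ⟨j, hj, rfl⟩)
        · exact ⟨fun h => by have := ia j (by omega) i (by omega) h; omega,
            Or.inl ⟨j, by omega, rfl⟩⟩
        · exact ⟨fun h => by have := iab i (by omega) j (by omega) h.symm; omega,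
            Or.inr ⟨j, hj, rfl⟩⟩
        · exact ⟨fun h => by have := ia _ (by omega) i (by omega) h; omega,
            Or.inl ⟨_, by omega, rfl⟩⟩
    have cb : ConnOn G ((Finset.range (l + 1)).image b ∪
        (Finset.range (k - i)).image fun j => a (i + 1 + j)) :=
      (connOn_image_range fun i hi => hb i (by omega)).union (conn ha (i + 1) (k - i) (by omega))
        (Finset.mem_image.2 ⟨l, by simp, rfl⟩)
        (Finset.mem_image.2 ⟨k - i - 1, by simp; omega, rfl⟩)
        (Or.inl (by rw [← hkl]; congr 1; omega))
    rw [e]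
    rcases Nat.eq_zero_or_pos i with rfl | hpos
    · simpa using cb
    · exact (connOn_image_range fun j hj => ha j (by omega)).union cb
        (Finset.mem_image.2 ⟨0, by simpa using hpos, rfl⟩)
        (Finset.mem_union_left _ (Finset.mem_image.2 ⟨0, by simp, rfl⟩)) (Or.inr h0)
  refine ⟨(connOn_image_range fun i hi => ha i (by omega)).union
    (connOn_image_range fun i hi => hb i (by omega)) (Finset.mem_image.2 ⟨0, by simp, rfl⟩)
    (Finset.mem_image.2 ⟨0, by simp, rfl⟩) (Or.inr h0), fun x hx => ?_⟩
  by_cases hxk : x = a k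
  · have e : ((Finset.range (k + 1)).image a ∪ (Finset.range (l + 1)).image b).erase x =
        (Finset.range k).image a ∪ (Finset.range l).image b := by
      ext y
      simp only [Finset.mem_erase, Finset.mem_union, Finset.mem_image, Finset.mem_range]
      constructor
      · rintro ⟨hy, ⟨j, hj, rfl⟩ | ⟨j, hj, rfl⟩⟩
        · exact Or.inl ⟨j, lt_of_le_of_ne (by omega) fun h => hy (by rw [hxk, h]), rfl⟩
        · exact Or.inr ⟨j, lt_of_le_of_ne (by omega) fun h => hy (by rw [hxk, hkl, h]), rfl⟩
      · rintro (⟨j, hj, rfl⟩ | ⟨j, hj, rfl⟩)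
        · exact ⟨fun h => by have := ia j (by omega) k le_rfl (h.trans hxk); omega,
            Or.inl ⟨j, by omega, rfl⟩⟩
        · exact ⟨fun h => by have := ib j (by omega) l le_rfl (h.trans (hxk.trans hkl)); omega,
            Or.inr ⟨j, by omega, rfl⟩⟩
    rw [e]
    exact (connOn_image_range fun i hi => ha i (by omega)).union
      (connOn_image_range fun i hi => hb i (by omega))
      (Finset.mem_image.2 ⟨0, by simp; omega, rfl⟩)
      (Finset.mem_image.2 ⟨0, by simp; omega, rfl⟩) (Or.inr h0)
  · simp only [Finset.mem_union, Finset.mem_image, Finset.mem_range] at hx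
    rcases hx with ⟨i, hi, rfl⟩ | ⟨i, hi, rfl⟩
    · exact side ha hb h0 hkl ia iab i (lt_of_le_of_ne (by omega) fun h => hxk (by rw [h]))
    · rw [Finset.union_comm]
      exact side hb ha h0.symm hkl.symm ib
        (fun i hi j hj h => (iab j hj i hi h.symm).symm) i
        (lt_of_le_of_ne (by omega) fun h => hxk (by rw [h, hkl]))

end Choosability

/-! ### Growth of balls without degree-choosable sets -/

section Growth

variable {V : Type*} {G : SimpleGraph V} {v : V} {r s : ℕ} {x y z t u w : V}

/-- The vertex `x` is reachable from `v` and has distance `r` from it. -/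
def Level (G : SimpleGraph V) (v : V) (r : ℕ) (x : V) : Prop :=
  G.Reachable v x ∧ G.dist v x = r

theorem Level.unique (h : Level G v r x) (h' : Level G v s x) : r = s := h.2.symm.trans h'.2

theorem Level.ne (h : Level G v r x) (h' : Level G v s y) (hrs : r ≠ s) : x ≠ y := by
  rintro rfl
  exact hrs (h.unique h')

theorem Level.of_adj (h : Level G v r x) (hxy : G.Adj x y) :
    ∃ s, Level G v s y ∧ s ≤ r + 1 ∧ r ≤ s + 1 := by
  have hy := h.1.trans hxy.reachable
  obtain ⟨p, hp⟩ := h.1.exists_walk_length_eq_dist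
  obtain ⟨q, hq⟩ := hy.exists_walk_length_eq_dist
  refine ⟨_, ⟨hy, rfl⟩, ?_, ?_⟩
  · have := G.dist_le (p.concat hxy)
    rw [SimpleGraph.Walk.length_concat, hp, h.2] at this
    exact this
  · have := G.dist_le (q.concat hxy.symm)
    rwa [SimpleGraph.Walk.length_concat, hq, h.2] at this

theorem Level.cases_adj (h : Level G v (r + 1) x) (hxy : G.Adj x y) :
    Level G v r y ∨ Level G v (r + 1) y ∨ Level G v (r + 2) y := by
  obtain ⟨s, hs, h1, h2⟩ := h.of_adj hxy
  have : s = r ∨ s = r + 1 ∨ s = r + 2 := by omega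
  rcases this with rfl | rfl | rfl <;> simp [hs]

theorem Level.exists_adj (h : Level G v (r + 1) x) : ∃ y, G.Adj x y ∧ Level G v r y := by
  obtain ⟨p, hp⟩ := h.1.symm.exists_walk_length_eq_dist
  rw [SimpleGraph.dist_comm, h.2] at hp
  cases p with
  | nil => simp at hp
  | @cons _ y _ hxy q =>
    rw [SimpleGraph.Walk.length_cons] at hp
    obtain ⟨s, hs, h1, h2⟩ := h.of_adj hxy
    have := G.dist_le q.reverse
    rw [SimpleGraph.Walk.length_reverse, hs.2] at this
    obtain rfl : s = r := by omega
    exact ⟨y, hxy, hs⟩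

theorem level_zero_iff : Level G v 0 x ↔ x = v := by
  refine ⟨fun h => (h.1.dist_eq_zero_iff.1 h.2).symm, ?_⟩
  rintro rfl
  exact ⟨SimpleGraph.Reachable.refl _, SimpleGraph.dist_self⟩

open Classical in
/-- A neighbor of `x` that is closer to the root `v`, if there is one. -/
noncomputable def parent (G : SimpleGraph V) (v x : V) : V :=
  if h : ∃ y, G.Adj x y ∧ ∃ r, Level G v r y ∧ Level G v (r + 1) x then h.choose else x

theorem Level.parent_spec (h : Level G v (r + 1) x) :
    G.Adj x (parent G v x) ∧ Level G v r (parent G v x) := by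
  obtain ⟨y, hxy, hy⟩ := h.exists_adj
  have hex : ∃ y, G.Adj x y ∧ ∃ r, Level G v r y ∧ Level G v (r + 1) x := ⟨y, hxy, r, hy, h⟩
  obtain ⟨h1, r', h2, h3⟩ := hex.choose_spec
  obtain rfl : r' = r := by have := h3.unique h; omega
  rw [parent, dif_pos hex]
  exact ⟨h1, h2⟩

theorem Level.iterate_parent (h : Level G v r x) : ∀ {i}, i ≤ r →
    Level G v (r - i) ((parent G v)^[i] x)
  | 0, _ => h
  | i + 1, hi => by
    rw [Function.iterate_succ_apply']
    have := h.iterate_parent (i := i) (by omega)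
    rw [show r - i = r - (i + 1) + 1 by omega] at this
    exact this.parent_spec.2

theorem Level.adj_iterate_parent (h : Level G v r x) {i : ℕ} (hi : i < r) :
    G.Adj ((parent G v)^[i] x) ((parent G v)^[i + 1] x) := by
  rw [Function.iterate_succ_apply']
  have := h.iterate_parent (i := i) hi.le
  rw [show r - i = r - (i + 1) + 1 by omega] at this
  exact this.parent_spec.1

/-- `C` consists of the ancestors of the vertices `x` and `y` of level `r` up to their first common
ancestor: the vertex set of a cycle, once the two paths are joined at `x` and `y`. -/
structure IsAncestorCycle [DecidableEq V] (G : SimpleGraph V) (v : V) (r : ℕ) (x y : V)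
    (C : Finset V) : Prop where
  left_mem : x ∈ C
  right_mem : y ∈ C
  parent_left_mem : parent G v x ∈ C
  parent_right_mem : parent G v y ∈ C
  exists_level : ∀ z ∈ C, ∃ s ≤ r, Level G v s z
  eq_of_level : ∀ z ∈ C, Level G v r z → z = x ∨ z = y
  eq_parent_of_level : ∀ z ∈ C, ∀ s, s + 1 = r → Level G v s z →
    z = parent G v x ∨ z = parent G v y
  grandparent_left_mem : parent G v x ≠ parent G v y → parent G v (parent G v x) ∈ C
  grandparent_right_mem : parent G v x ≠ parent G v y → parent G v (parent G v y) ∈ C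
  /-- The first common ancestor is alone in its level, and all other vertices have a parent in `C`
  and, except for `x` and `y`, also a child. -/
  neighbors : ∀ a ∈ C, ∀ b ∈ C, ∀ s, Level G v s a → Level G v s b → a ≠ b →
    (parent G v a ∈ C ∧ 1 ≤ s) ∧ (a = x ∨ a = y ∨ ∃ c ∈ C, G.Adj a c ∧ Level G v (s + 1) c)
  twoConn : G.Adj x y → TwoConnOn G C
  twoConn_insert : ∀ t, Level G v (r + 1) t → G.Adj t x → G.Adj t y → TwoConnOn G (insert t C)

theorem exists_isAncestorCycle [DecidableEq V] (hx : Level G v r x) (hy : Level G v r y)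
    (hxy : x ≠ y) : ∃ C, IsAncestorCycle G v r x y C := by
  classical
  have hex : ∃ k, (parent G v)^[k] x = (parent G v)^[k] y := by
    refine ⟨r, ?_⟩
    have h1 := hx.iterate_parent le_rfl
    have h2 := hy.iterate_parent le_rfl
    rw [Nat.sub_self, level_zero_iff] at h1 h2
    rw [h1, h2]
  obtain ⟨k, hk, hmin⟩ : ∃ k, (parent G v)^[k] x = (parent G v)^[k] y ∧
      ∀ i < k, (parent G v)^[i] x ≠ (parent G v)^[i] y :=
    ⟨Nat.find hex, Nat.find_spec hex, fun i hi => Nat.find_min hex hi⟩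
  have hk1 : 1 ≤ k := Nat.one_le_iff_ne_zero.2 (by rintro rfl; exact hxy hk)
  have hkr : k ≤ r := by
    by_contra h
    refine hmin r (by omega) ?_
    have h1 := hx.iterate_parent le_rfl
    have h2 := hy.iterate_parent le_rfl
    rw [Nat.sub_self, level_zero_iff] at h1 h2
    rw [h1, h2]
  have lx : ∀ i ≤ k, Level G v (r - i) ((parent G v)^[i] x) :=
    fun i hi => hx.iterate_parent (hi.trans hkr)
  have ly : ∀ i ≤ k, Level G v (r - i) ((parent G v)^[i] y) :=
    fun i hi => hy.iterate_parent (hi.trans hkr)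
  have ax : ∀ i < k, G.Adj ((parent G v)^[i] x) ((parent G v)^[i + 1] x) :=
    fun i hi => hx.adj_iterate_parent (hi.trans_le hkr)
  have ay : ∀ i < k, G.Adj ((parent G v)^[i] y) ((parent G v)^[i + 1] y) :=
    fun i hi => hy.adj_iterate_parent (hi.trans_le hkr)
  have ix : ∀ i ≤ k, ∀ j ≤ k, (parent G v)^[i] x = (parent G v)^[j] x → i = j :=
    fun i hi j hj h => by have := (lx i hi).unique (h ▸ lx j hj); omega
  have iy : ∀ i ≤ k, ∀ j ≤ k, (parent G v)^[i] y = (parent G v)^[j] y → i = j :=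
    fun i hi j hj h => by have := (ly i hi).unique (h ▸ ly j hj); omega
  have ixy : ∀ i ≤ k, ∀ j ≤ k, (parent G v)^[i] x = (parent G v)^[j] y → i = k ∧ j = k :=
    fun i hi j hj h => by
      have := (lx i hi).unique (h ▸ ly j hj)
      obtain rfl : i = j := by omega
      have : ¬ i < k := fun hlt => hmin i hlt h
      omega
  let C := (Finset.range (k + 1)).image (fun i => (parent G v)^[i] x) ∪
    (Finset.range (k + 1)).image (fun i => (parent G v)^[i] y)
  have memx : ∀ i ≤ k, (parent G v)^[i] x ∈ C := fun i hi =>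
    Finset.mem_union_left _ (Finset.mem_image.2 ⟨i, Finset.mem_range.2 (by omega), rfl⟩)
  have memy : ∀ i ≤ k, (parent G v)^[i] y ∈ C := fun i hi =>
    Finset.mem_union_right _ (Finset.mem_image.2 ⟨i, Finset.mem_range.2 (by omega), rfl⟩)
  have mem : ∀ z ∈ C, ∃ i ≤ k, Level G v (r - i) z ∧
      (z = (parent G v)^[i] x ∨ z = (parent G v)^[i] y) := by
    intro z hz
    rcases Finset.mem_union.1 hz with h | h <;> obtain ⟨i, hi, rfl⟩ := Finset.mem_image.1 h <;>
      have hi := Nat.lt_succ_iff.1 (Finset.mem_range.1 hi)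
    · exact ⟨i, hi, lx i hi, Or.inl rfl⟩
    · exact ⟨i, hi, ly i hi, Or.inr rfl⟩
  have two : parent G v x ≠ parent G v y → 2 ≤ k := fun h => by
    by_contra h2
    obtain rfl : k = 1 := by omega
    exact h hk
  refine ⟨C, memx 0 (by omega), memy 0 (by omega), memx 1 hk1, memy 1 hk1, fun z hz => ?_,
    fun z hz hl => ?_, fun z hz s hs hl => ?_, fun h => memx 2 (two h), fun h => memy 2 (two h),
    fun a ha b hb s hla hlb hab => ?_, fun h => ?_, fun t ht htx hty => ?_⟩
  · obtain ⟨i, hi, h, -⟩ := mem z hz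
    exact ⟨_, Nat.sub_le _ _, h⟩
  · obtain ⟨i, hi, h, h'⟩ := mem z hz
    obtain rfl : i = 0 := by have := h.unique hl; omega
    exact h'
  · obtain ⟨i, hi, h, h'⟩ := mem z hz
    obtain rfl : i = 1 := by have := h.unique hl; omega
    exact h'
  · obtain ⟨i, hi, h, h'⟩ := mem a ha
    obtain ⟨j, hj, g, g'⟩ := mem b hb
    have hsi := h.unique hla
    have hsj := g.unique hlb
    obtain rfl : i = j := by omega
    have hik : i < k := by
      refine lt_of_le_of_ne hi fun hik => hab ?_
      subst hik
      rw [← hk, or_self] at h' g'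
      exact h'.trans g'.symm
    refine ⟨⟨?_, by omega⟩, ?_⟩
    · rcases h' with rfl | rfl
      · rw [← Function.iterate_succ_apply' (parent G v)]
        exact memx _ hik
      · rw [← Function.iterate_succ_apply' (parent G v)]
        exact memy _ hik
    · rcases i with _ | i
      · rcases h' with h' | h'
        · exact Or.inl h'
        · exact Or.inr (Or.inl h')
      · right; right
        rcases h' with rfl | rfl
        · refine ⟨_, memx i (by omega), (ax i (by omega)).symm, ?_⟩
          convert lx i (by omega) using 1
          omega
        · refine ⟨_, memy i (by omega), (ay i (by omega)).symm, ?_⟩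
          convert ly i (by omega) using 1
          omega
  · exact twoConnOn_of_paths hk1 hk1 ax ay h hk ix iy ixy
  · -- the path from `x` is prolonged by `t`
    let a : ℕ → V := fun i => i.casesOn t fun j => (parent G v)^[j] x
    have hla : ∀ i ≤ k + 1, Level G v (r + 1 - i) (a i) := by
      rintro (_ | i) hi
      · exact ht
      · simpa using lx i (by omega)
    have e : insert t C = (Finset.range (k + 2)).image a ∪
        (Finset.range (k + 1)).image (fun i => (parent G v)^[i] y) := by
      have : (Finset.range (k + 2)).image a =
          insert t ((Finset.range (k + 1)).image fun i => (parent G v)^[i] x) := by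
        rw [Finset.range_add_one', Finset.image_insert, Finset.map_eq_image, Finset.image_image]
        rfl
      rw [this, Finset.insert_union]
    rw [e]
    refine twoConnOn_of_paths (k := k + 1) (by omega) hk1 ?_ ay hty hk ?_ iy ?_
    · rintro (_ | i) hi
      · exact htx
      · exact ax i (by omega)
    · intro i hi j hj h
      have := (hla i hi).unique (h ▸ hla j hj)
      omega
    · rintro (_ | i) hi j hj h
      · have := ht.unique (show Level G v (r - j) t by
          rw [show t = _ from h]
          exact ly j hj)
        omega
      · have := ixy i (by omega) j hj h
        omega

/-- The two-connected vertex sets in the ball of radius `R` around `v` are regular of some degree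
`k` and have no proper coloring with `k` colors. -/
def RegularBall (G : SimpleGraph V) [DecidableEq V] (v : V) (R : ℕ) : Prop :=
  ∀ B : Finset V, B.Nonempty → (∀ x ∈ B, ∃ s ≤ R, Level G v s x) → TwoConnOn G B →
    ∃ k, (∀ u ∈ B, degIn G B u = k) ∧
      ¬ ∃ f : V → ℕ, (∀ u ∈ B, f u < k) ∧ ∀ u ∈ B, ∀ w ∈ B, G.Adj u w → f u ≠ f w

variable [DecidableEq V] {R : ℕ}

theorem RegularBall.degIn_eq (hR : RegularBall G v R) {B : Finset V}
    (hB : ∀ x ∈ B, ∃ s ≤ R, Level G v s x) (h2 : TwoConnOn G B) (hx : x ∈ B) (hy : y ∈ B) :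
    degIn G B x = degIn G B y := by
  obtain ⟨k, hk, -⟩ := hR B ⟨x, hx⟩ hB h2
  rw [hk x hx, hk y hy]

/-- A second parent would close an even cycle, which has no chord since it is regular. -/
theorem RegularBall.eq_of_adj (hR : RegularBall G v R) (hr : r + 1 ≤ R) (ht : Level G v (r + 1) t)
    (hx : Level G v r x) (hy : Level G v r y) (htx : G.Adj t x) (hty : G.Adj t y) : x = y := by
  by_contra hxy
  obtain ⟨C, hC⟩ := exists_isAncestorCycle hx hy hxy
  have lev : ∀ z ∈ insert t C, ∃ s ≤ r + 1, Level G v s z := fun z hz => by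
    rcases Finset.mem_insert.1 hz with rfl | hz
    · exact ⟨_, le_rfl, ht⟩
    · obtain ⟨s, hs, h⟩ := hC.exists_level z hz
      exact ⟨s, by omega, h⟩
  obtain ⟨k, hk, hcol⟩ := hR (insert t C) ⟨t, by simp⟩
    (fun z hz => (lev z hz).imp fun s hs => ⟨hs.1.trans hr, hs.2⟩) (hC.twoConn_insert t ht htx hty)
  have hk2 : k ≤ 2 := by
    rw [← hk t (by simp)]
    refine degIn_le_two (x := x) (y := y) fun w hw htw => ?_
    have hwC := (Finset.mem_insert.1 hw).resolve_left htw.ne'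
    obtain ⟨s, hs, h⟩ := hC.exists_level w hwC
    obtain ⟨s', hs', h', h''⟩ := ht.of_adj htw
    have := h.unique hs'
    obtain rfl : s = r := by omega
    exact hC.eq_of_level w hwC h
  have hk2' : 2 ≤ k := by
    classical
    rw [← hk t (by simp), ← Finset.card_pair hxy]
    refine Finset.card_le_card fun w hw => ?_
    simp only [Finset.mem_insert, Finset.mem_singleton] at hw
    rcases hw with rfl | rfl <;> simp [hC.left_mem, hC.right_mem, *]
  -- the parity of the level is a proper coloring
  refine hcol ⟨fun z => G.dist v z % 2, fun z _ => (Nat.mod_lt _ two_pos).trans_le hk2',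
    fun a ha b hb hab heq => ?_⟩
  obtain ⟨s, hs, hla⟩ := lev a ha
  obtain ⟨s', hlb, h1, h2⟩ := hla.of_adj hab
  simp only [hla.2, hlb.2] at heq
  obtain rfl : s = s' := by omega
  have mem : ∀ c ∈ insert t C, ∀ d ∈ insert t C, Level G v s c → Level G v s d → c ≠ d →
      c ∈ C := by
    intro c hc d hd hlc hld hcd
    refine (Finset.mem_insert.1 hc).resolve_left ?_
    rintro rfl
    obtain ⟨s', hs', hl⟩ := hC.exists_level d ((Finset.mem_insert.1 hd).resolve_left hcd.symm)
    have := hl.unique hld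
    have := ht.unique hlc
    omega
  have haC := mem a ha b hb hla hlb hab.ne
  have hbC := mem b hb a ha hlb hla hab.ne'
  obtain ⟨⟨hp, hs1⟩, hc⟩ := hC.neighbors a haC b hbC s hla hlb hab.ne
  obtain ⟨s, rfl⟩ : ∃ s', s = s' + 1 := ⟨s - 1, by omega⟩
  have hc' : ∃ c ∈ insert t C, G.Adj a c ∧ Level G v (s + 2) c := by
    rcases hc with rfl | rfl | ⟨c, hc, h⟩
    · exact ⟨t, by simp, htx.symm, by have := hx.unique hla; subst this; exact ht⟩
    · exact ⟨t, by simp, hty.symm, by have := hy.unique hla; subst this; exact ht⟩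
    · exact ⟨c, Finset.mem_insert_of_mem hc, h⟩
  obtain ⟨c, hc, hac, hlc⟩ := hc'
  obtain ⟨hap, hlp⟩ := hla.parent_spec
  have := three_le_degIn (Finset.mem_insert_of_mem hp) hb hc hap hab hac
    (hlp.ne hlb (by omega))
    (hlp.ne hlc (by omega))
    (hlb.ne hlc (by omega))
  rw [hk a ha] at this
  omega

theorem RegularBall.parent_eq (hR : RegularBall G v R) (hr : r + 1 ≤ R)
    (ht : Level G v (r + 1) t) (hx : Level G v r x) (htx : G.Adj t x) : parent G v t = x :=
  hR.eq_of_adj hr ht ht.parent_spec.2 hx ht.parent_spec.1 htx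

/-- Two neighbors of `u` in its own level are adjacent: otherwise the union of two cycles through
`u` and its parent is not regular. -/
theorem RegularBall.adj_of_level (hR : RegularBall G v R) (hr : r + 1 ≤ R)
    (hu : Level G v (r + 1) u) (hx : Level G v (r + 1) x) (hy : Level G v (r + 1) y)
    (hux : G.Adj u x) (huy : G.Adj u y) (hxy : x ≠ y) : G.Adj x y := by
  by_contra hn
  obtain ⟨C, hC⟩ := exists_isAncestorCycle hu hx hux.ne
  obtain ⟨C', hC'⟩ := exists_isAncestorCycle hu hy huy.ne
  obtain ⟨hup, hlp⟩ := hu.parent_spec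
  have h2 : TwoConnOn G (C ∪ C') := (hC.twoConn hux).union (hC'.twoConn huy) hup.ne
    hC.left_mem hC'.left_mem hC.parent_left_mem hC'.parent_left_mem
  have lev : ∀ z ∈ C ∪ C', ∃ s ≤ r + 1, Level G v s z := fun z hz =>
    (Finset.mem_union.1 hz).elim (hC.exists_level z) (hC'.exists_level z)
  have h3 : 3 ≤ degIn G (C ∪ C') u := three_le_degIn
    (Finset.mem_union_left _ hC.parent_left_mem) (Finset.mem_union_left _ hC.right_mem)
    (Finset.mem_union_right _ hC'.right_mem) hup hux huy
    (hlp.ne hx (by omega))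
    (hlp.ne hy (by omega)) hxy
  have hle : degIn G (C ∪ C') x ≤ 2 := by
    refine degIn_le_two (x := u) (y := parent G v x) fun w hw hxw => ?_
    obtain ⟨s, hs, hlw⟩ := lev w hw
    rcases hx.cases_adj hxw with h | h | h
    · exact Or.inr (hR.parent_eq hr hx h hxw).symm
    · left
      rcases Finset.mem_union.1 hw with hw | hw
      · exact (hC.eq_of_level w hw h).resolve_right hxw.ne'
      · refine (hC'.eq_of_level w hw h).resolve_right ?_
        rintro rfl
        exact hn hxw
    · have := hlw.unique h
      omega
  have := hR.degIn_eq (fun z hz => (lev z hz).imp fun s hs => ⟨hs.1.trans hr, hs.2⟩) h2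
    (x := u) (y := x) (Finset.mem_union_left _ hC.left_mem) (Finset.mem_union_left _ hC.right_mem)
  omega

/-- A vertex with two neighbors in its own level has the same parent as these: otherwise the cycle
through one of them, enlarged by the other one, is not regular. -/
theorem RegularBall.parent_eq_parent (hR : RegularBall G v R) (hr : r + 1 ≤ R)
    (hu : Level G v (r + 1) u) (hx : Level G v (r + 1) x) (hy : Level G v (r + 1) y)
    (hux : G.Adj u x) (huy : G.Adj u y) (hxy : x ≠ y) : parent G v x = parent G v u := by
  by_contra hp
  have hp' : parent G v u ≠ parent G v x := Ne.symm hp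
  have hxy' := hR.adj_of_level hr hu hx hy hux huy hxy
  obtain ⟨C, hC⟩ := exists_isAncestorCycle hu hx hux.ne
  obtain ⟨hup, hlp⟩ := hu.parent_spec
  obtain ⟨hxp, hlq⟩ := hx.parent_spec
  obtain ⟨r, rfl⟩ : ∃ r', r = r' + 1 := by
    refine ⟨r - 1, ?_⟩
    have : r ≠ 0 := by
      rintro rfl
      rw [level_zero_iff] at hlp hlq
      exact hp (hlq.trans hlp.symm)
    omega
  have lev : ∀ z ∈ C, ∃ s ≤ R, Level G v s z := fun z hz =>
    (hC.exists_level z hz).imp fun s hs => ⟨hs.1.trans hr, hs.2⟩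
  have hC2 := hC.twoConn hux
  -- the parents are not adjacent, since the cycle has no chord
  have hpp : ¬ G.Adj (parent G v u) (parent G v x) := by
    intro hadj
    have h3 : 3 ≤ degIn G C (parent G v u) := three_le_degIn hC.left_mem hC.parent_right_mem
      (hC.grandparent_left_mem hp') hup.symm hadj hlp.parent_spec.1
      (hu.ne hlq (by omega))
      (hu.ne hlp.parent_spec.2 (by omega))
      (hlq.ne hlp.parent_spec.2 (by omega))
    have hle : degIn G C u ≤ 2 := by
      refine degIn_le_two (x := x) (y := parent G v u) fun w hw huw => ?_
      obtain ⟨s, hs, hlw⟩ := hC.exists_level w hw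
      rcases hu.cases_adj huw with h | h | h
      · exact Or.inr (hR.parent_eq hr hu h huw).symm
      · exact Or.inl ((hC.eq_of_level w hw h).resolve_left huw.ne')
      · have := hlw.unique h
        omega
    have := hR.degIn_eq lev hC2 hC.left_mem hC.parent_left_mem
    omega
  have h2 : TwoConnOn G (insert y C) :=
    hC2.insert hux.ne hC.left_mem hC.right_mem huy.symm hxy'.symm
  have lev' : ∀ z ∈ insert y C, ∃ s ≤ r + 2, Level G v s z := fun z hz => by
    rcases Finset.mem_insert.1 hz with rfl | hz
    · exact ⟨_, le_rfl, hy⟩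
    · exact hC.exists_level z hz
  have h3 : 3 ≤ degIn G (insert y C) u := three_le_degIn
    (Finset.mem_insert_of_mem hC.parent_left_mem) (Finset.mem_insert_of_mem hC.right_mem)
    (Finset.mem_insert_self _ _) hup hux huy
    (hlp.ne hx (by omega))
    (hlp.ne hy (by omega)) hxy
  -- one of the two parents is not adjacent to `y`
  have key : ∀ a b, G.Adj a b → Level G v (r + 2) a → Level G v (r + 2) b →
      (∀ z ∈ C, Level G v (r + 2) z → z = a ∨ z = b) →
      (∀ z ∈ C, Level G v (r + 1) z → z = parent G v a ∨ z = parent G v b) →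
      ¬ G.Adj (parent G v a) (parent G v b) → parent G v a ∈ C → parent G v b ≠ parent G v a →
      parent G v y ≠ parent G v a → False := by
    intro a b hab hla hlb hz1 hz2 hnadj hmem hne hya
    have hle : degIn G (insert y C) (parent G v a) ≤ 2 := by
      refine degIn_le_two (x := a) (y := parent G v (parent G v a)) fun w hw haw => ?_
      have hlpa := hla.parent_spec.2
      rcases hlpa.cases_adj haw with h | h | h
      · exact Or.inr (hR.parent_eq (by omega) hlpa h haw).symm
      · exfalso
        rcases Finset.mem_insert.1 hw with rfl | hw
        · have := hy.unique h
          omega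
        · rcases hz2 w hw h with rfl | rfl
          · exact haw.ne rfl
          · exact hnadj haw
      · left
        have hpw := hR.parent_eq hr h hlpa haw.symm
        rcases Finset.mem_insert.1 hw with rfl | hw
        · exact (hya hpw).elim
        · refine (hz1 w hw h).resolve_right ?_
          rintro rfl
          exact hne hpw
    have := hR.degIn_eq (fun z hz => (lev' z hz).imp fun s hs => ⟨hs.1.trans hr, hs.2⟩) h2
      (Finset.mem_insert_of_mem hC.left_mem) (Finset.mem_insert_of_mem hmem)
    omega
  by_cases hyu : parent G v y = parent G v u
  · exact key x u hux.symm hx hu (fun z hz h => (hC.eq_of_level z hz h).symm)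
      (fun z hz h => (hC.eq_parent_of_level z hz _ rfl h).symm) (fun h => hpp h.symm)
      hC.parent_right_mem hp' (fun h => hp (h.symm.trans hyu))
  · exact key u x hux hu hx (fun z hz h => hC.eq_of_level z hz h)
      (fun z hz h => hC.eq_parent_of_level z hz _ rfl h) hpp hC.parent_left_mem hp hyu

/-- If `u` has a neighbor in its own level, then the neighbors that a child of `u` has in its own
level are children of `u` as well: otherwise the union of two cycles through `u` and its parent is
not regular. -/
theorem RegularBall.parent_eq_of_child (hR : RegularBall G v R) (hr : r + 2 ≤ R)
    (hu : Level G v (r + 1) u) (hx : Level G v (r + 1) x) (hux : G.Adj u x)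
    (hw : Level G v (r + 2) w) (huw : G.Adj u w) (hz : Level G v (r + 2) z) (hwz : G.Adj w z) :
    parent G v z = u := by
  by_contra hp
  have hpw : parent G v w = u := hR.parent_eq hr hw hu huw.symm
  obtain ⟨C, hC⟩ := exists_isAncestorCycle hw hz hwz.ne
  obtain ⟨C', hC'⟩ := exists_isAncestorCycle hu hx hux.ne
  obtain ⟨hup, hlp⟩ := hu.parent_spec
  have huC : u ∈ C := hpw ▸ hC.parent_left_mem
  have hpC : parent G v u ∈ C := by
    have := hC.grandparent_left_mem (by rw [hpw]; exact Ne.symm hp)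
    rwa [hpw] at this
  have h2 : TwoConnOn G (C ∪ C') := (hC.twoConn hwz).union (hC'.twoConn hux) hup.ne
    huC hC'.left_mem hpC hC'.parent_left_mem
  have h3 : 3 ≤ degIn G (C ∪ C') u := three_le_degIn
    (Finset.mem_union_left _ hpC) (Finset.mem_union_left _ hC.left_mem)
    (Finset.mem_union_right _ hC'.right_mem) hup huw hux
    (hlp.ne hw (by omega))
    (hlp.ne hx (by omega))
    (hw.ne hx (by omega))
  have lev : ∀ y ∈ C ∪ C', ∃ s ≤ r + 2, Level G v s y := fun y hy => by
    rcases Finset.mem_union.1 hy with hy | hy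
    · exact hC.exists_level y hy
    · obtain ⟨s, hs, h⟩ := hC'.exists_level y hy
      exact ⟨s, by omega, h⟩
  have hle : degIn G (C ∪ C') w ≤ 2 := by
    refine degIn_le_two (x := u) (y := z) fun y hy hwy => ?_
    rcases hw.cases_adj hwy with h | h | h
    · exact Or.inl ((hR.parent_eq hr hw h hwy).symm.trans hpw)
    · right
      rcases Finset.mem_union.1 hy with hy | hy
      · exact (hC.eq_of_level y hy h).resolve_left hwy.ne'
      · obtain ⟨s, hs, h'⟩ := hC'.exists_level y hy
        have := h'.unique h
        omega
    · obtain ⟨s, hs, h'⟩ := lev y hy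
      have := h'.unique h
      omega
  have := hR.degIn_eq (fun y hy => (lev y hy).imp fun s hs => ⟨hs.1.trans hr, hs.2⟩) h2
    (Finset.mem_union_right _ hC'.left_mem) (Finset.mem_union_left _ hC.left_mem)
  omega

/-- The vertex `x` has at least three neighbors, and not all of them are adjacent. -/
def HasOpenNeighborhood [Fintype V] (G : SimpleGraph V) (x : V) : Prop :=
  3 ≤ degIn G Finset.univ x ∧ ∃ a b, G.Adj x a ∧ G.Adj x b ∧ a ≠ b ∧ ¬ G.Adj a b

theorem HasOpenNeighborhood.exists_adj [Fintype V] (h : HasOpenNeighborhood G x) (a b : V) :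
    ∃ c, G.Adj x c ∧ c ≠ a ∧ c ≠ b := by
  by_contra hn
  push Not at hn
  have := degIn_le_two (G := G) (B := Finset.univ) (u := x) (x := a) (y := b) fun w _ hw => by
    by_cases hwa : w = a
    · exact Or.inl hwa
    · exact Or.inr (hn w hw hwa)
  have := h.1
  omega

theorem RegularBall.exists_child [Fintype V] (hR : RegularBall G v R) (hr : r + 1 ≤ R)
    (hu : Level G v (r + 1) u) (ho : HasOpenNeighborhood G u) :
    ∃ w, G.Adj u w ∧ Level G v (r + 2) w := by
  by_contra hn
  push Not at hn
  have nb : ∀ w, G.Adj u w → w ≠ parent G v u → Level G v (r + 1) w := fun w hw hne => by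
    rcases hu.cases_adj hw with h | h | h
    · exact (hne (hR.parent_eq hr hu h hw).symm).elim
    · exact h
    · exact (hn w hw h).elim
  -- a neighbor in the same level is adjacent to the parent, because there is another one
  have par : ∀ w, G.Adj u w → w ≠ parent G v u → G.Adj (parent G v u) w := fun w hw hne => by
    obtain ⟨y, hy, hyp, hyw⟩ := ho.exists_adj (parent G v u) w
    have hlw := nb w hw hne
    rw [← hR.parent_eq_parent hr hu hlw (nb y hy hyp) hw hy hyw.symm]
    exact hlw.parent_spec.1.symm
  obtain ⟨a, b, hua, hub, hab, hnab⟩ := ho.2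
  by_cases ha : a = parent G v u
  · subst ha
    exact hnab (par b hub hab.symm)
  by_cases hb : b = parent G v u
  · subst hb
    exact hnab (par a hua hab).symm
  exact hnab (hR.adj_of_level hr hu (nb a hua ha) (nb b hub hb) hua hub hab)

theorem RegularBall.exists_grandchildren [Fintype V] (hR : RegularBall G v R) (hr : r + 3 ≤ R)
    (hu : Level G v (r + 1) u) (ho : ∀ x, ∀ s ≤ R, Level G v s x → HasOpenNeighborhood G x) :
    ∃ x y, x ≠ y ∧ Level G v (r + 3) x ∧ Level G v (r + 3) y ∧
      parent G v (parent G v x) = u ∧ parent G v (parent G v y) = u := by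
  obtain ⟨w, huw, hw⟩ := hR.exists_child (by omega) hu (ho u _ (by omega) hu)
  have hpw : parent G v w = u := hR.parent_eq (by omega) hw hu huw.symm
  by_cases hw' : ∃ w', G.Adj u w' ∧ Level G v (r + 2) w' ∧ w' ≠ w
  · obtain ⟨w', huw', hlw', hne⟩ := hw'
    have hpw' : parent G v w' = u := hR.parent_eq (by omega) hlw' hu huw'.symm
    obtain ⟨x, hwx, hx⟩ := hR.exists_child (by omega) hw (ho w _ (by omega) hw)
    obtain ⟨y, hwy, hy⟩ := hR.exists_child (by omega) hlw' (ho w' _ (by omega) hlw')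
    have hpx : parent G v x = w := hR.parent_eq hr hx hw hwx.symm
    have hpy : parent G v y = w' := hR.parent_eq hr hy hlw' hwy.symm
    exact ⟨x, y, fun h => hne (by rw [← hpy, ← h, hpx]), hx, hy, by rw [hpx, hpw],
      by rw [hpy, hpw']⟩
  · push Not at hw'
    -- `w` is the only child of `u`, so that `u` has a neighbor in its own level
    obtain ⟨x, hux, hxp, hxw⟩ := (ho u _ (by omega) hu).exists_adj (parent G v u) w
    have hx : Level G v (r + 1) x := by
      rcases hu.cases_adj hux with h | h | h
      · exact (hxp (hR.parent_eq (by omega) hu h hux).symm).elim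
      · exact h
      · exact (hxw (hw' x hux h)).elim
    have nb : ∀ y, G.Adj w y → y ≠ u → Level G v (r + 3) y := fun y hwy hyu => by
      rcases hw.cases_adj hwy with h | h | h
      · exact (hyu ((hR.parent_eq (by omega) hw h hwy).symm.trans hpw)).elim
      · have hpy := hR.parent_eq_of_child (by omega) hu hx hux hw huw h hwy
        have := h.parent_spec.1
        rw [hpy] at this
        exact (hwy.ne' (hw' y this.symm h)).elim
      · exact h
    obtain ⟨y, hwy, hyu, -⟩ := (ho w _ (by omega) hw).exists_adj u u
    obtain ⟨y', hwy', hyu', hne⟩ := (ho w _ (by omega) hw).exists_adj u y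
    have hy := nb y hwy hyu
    have hy' := nb y' hwy' hyu'
    exact ⟨y, y', hne.symm, hy, hy', by rw [hR.parent_eq hr hy hw hwy.symm, hpw],
      by rw [hR.parent_eq hr hy' hw hwy'.symm, hpw]⟩

open Classical in
/-- The number of vertices doubles with every second level. -/
theorem RegularBall.two_pow_le [Fintype V] (hR : RegularBall G v R)
    (ho : ∀ x, ∀ s ≤ R, Level G v s x → HasOpenNeighborhood G x) :
    ∀ j, 2 * j + 1 ≤ R → 2 ^ j ≤ (Finset.univ.filter (Level G v (2 * j + 1))).card
  | 0, _ => by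
    obtain ⟨a, -, ha, -⟩ := (ho v 0 (by omega) (level_zero_iff.2 rfl)).2
    refine Finset.card_pos.2 ⟨a, ?_⟩
    obtain ⟨s, hs, h1, h2⟩ := (level_zero_iff.2 rfl : Level G v 0 v).of_adj ha
    have : s ≠ 0 := by
      rintro rfl
      exact ha.ne (level_zero_iff.1 hs).symm
    obtain rfl : s = 1 := by omega
    simpa using hs
  | j + 1, hj => by
    have ih := hR.two_pow_le ho j (by omega)
    have hmaps : ∀ x ∈ Finset.univ.filter (Level G v (2 * (j + 1) + 1)),
        parent G v (parent G v x) ∈ Finset.univ.filter (Level G v (2 * j + 1)) := fun x hx => by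
      simp only [Finset.mem_filter_univ] at hx ⊢
      exact hx.parent_spec.2.parent_spec.2
    rw [Finset.card_eq_sum_card_fiberwise hmaps, pow_succ]
    refine (Nat.mul_le_mul_right 2 ih).trans ?_
    rw [← smul_eq_mul]
    refine Finset.card_nsmul_le_sum _ _ 2 fun u hu => ?_
    obtain ⟨x, y, hxy, hx, hy, hxu, hyu⟩ :=
      hR.exists_grandchildren (by omega) (by simpa using hu) ho
    refine Finset.one_lt_card.2 ⟨x, ?_, y, ?_, hxy⟩ <;>
      simp only [Finset.mem_filter, Finset.mem_univ, true_and]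
    · exact ⟨hx, hxu⟩
    · exact ⟨hy, hyu⟩

/-- If all neighborhoods in a ball of logarithmic radius are open, then the ball contains a
two-connected set that is not regular or can be colored with as many colors as the degree. -/
theorem not_regularBall [Fintype V] {m : ℕ} (hm : Fintype.card V < 2 ^ m)
    (ho : ∀ x, ∀ s ≤ 2 * m + 1, Level G v s x → HasOpenNeighborhood G x) :
    ¬ RegularBall G v (2 * m + 1) := fun hR =>
  ((hR.two_pow_le ho m le_rfl).trans (Finset.card_le_univ _)).not_gt hm

end Growth

/-! ### Networks and local functions -/

section Locality

/-- A graph together with a list-assignment. -/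
structure Network (V κ : Type*) where
  /-- The graph. -/
  graph : SimpleGraph V
  /-- The lists of colors. -/
  list : V → Finset κ

/-- There is a walk of length at most `k` from `v` to `u`. -/
def Near {V : Type*} (G : SimpleGraph V) (k : ℕ) (v u : V) : Prop :=
  ∃ p : G.Walk v u, p.length ≤ k

variable {V κ α : Type*} {G : SimpleGraph V} {N N' : Network V κ} {j k l : ℕ} {u v w : V}

theorem Near.refl (G : SimpleGraph V) (k : ℕ) (v : V) : Near G k v v := ⟨.nil, Nat.zero_le _⟩

theorem Near.symm (h : Near G k v u) : Near G k u v :=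
  h.elim fun p hp => ⟨p.reverse, by rwa [SimpleGraph.Walk.length_reverse]⟩

theorem Near.mono (h : Near G k v u) (hkl : k ≤ l) : Near G l v u :=
  h.imp fun _ hp => hp.trans hkl

theorem Near.trans (h : Near G k v u) (h' : Near G l u w) : Near G (k + l) v w := by
  obtain ⟨p, hp⟩ := h
  obtain ⟨q, hq⟩ := h'
  exact ⟨p.append q, by rw [SimpleGraph.Walk.length_append]; omega⟩

theorem near_of_adj (h : G.Adj v u) : Near G 1 v u := ⟨.cons h .nil, le_rfl⟩

theorem near_zero_iff : Near G 0 v u ↔ u = v := by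
  constructor
  · rintro ⟨p, hp⟩
    exact (SimpleGraph.Walk.eq_of_length_eq_zero (Nat.le_zero.1 hp)).symm
  · rintro rfl
    exact Near.refl _ _ _

theorem near_succ_iff : Near G (k + 1) v u ↔ u = v ∨ ∃ w, G.Adj v w ∧ Near G k w u := by
  constructor
  · rintro ⟨p, hp⟩
    cases p with
    | nil => exact Or.inl rfl
    | cons h q => exact Or.inr ⟨_, h, q, by simpa using hp⟩
  · rintro (rfl | ⟨w, hw, h⟩)
    · exact Near.refl _ _ _
    · exact ((near_of_adj hw).trans h).mono (by omega)

/-- In the ball of radius `k` around `v`, the vertices have the same lists and the same neighbors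
in both networks. -/
def Agree (N N' : Network V κ) (k : ℕ) (v : V) : Prop :=
  ∀ u, Near N.graph k v u → N.graph.Adj u = N'.graph.Adj u ∧ N.list u = N'.list u

theorem Agree.of_near (h : Agree N N' k v) (hu : Near N.graph j v u) (hjl : j + l ≤ k) :
    Agree N N' l u := fun w hw => h w ((hu.trans hw).mono hjl)

theorem Agree.mono (h : Agree N N' k v) (hlk : l ≤ k) : Agree N N' l v :=
  h.of_near (Near.refl _ 0 v) (by omega)

theorem Agree.of_adj (h : Agree N N' k v) (hu : N.graph.Adj v u) (hl : l + 1 ≤ k) :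
    Agree N N' l u := h.of_near (near_of_adj hu) (by omega)

theorem Agree.adj_iff (h : Agree N N' k v) : N.graph.Adj v u ↔ N'.graph.Adj v u := by
  rw [(h v (Near.refl _ _ _)).1]

theorem Agree.list_eq (h : Agree N N' k v) : N.list v = N'.list v := (h v (Near.refl _ _ _)).2

theorem Agree.near_iff (h : Agree N N' k v) (hjk : j ≤ k) :
    Near N.graph j v u ↔ Near N'.graph j v u := by
  induction j generalizing k v with
  | zero => rw [near_zero_iff, near_zero_iff]
  | succ j ih =>
    rw [near_succ_iff, near_succ_iff]
    refine or_congr_right (exists_congr fun w => ?_)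
    rw [← h.adj_iff]
    exact and_congr_right fun hw => ih (h.of_adj hw hjk) le_rfl

theorem Agree.symm (h : Agree N N' k v) : Agree N' N k v := fun u hu => by
  have := h u ((h.near_iff le_rfl).2 hu)
  exact ⟨this.1.symm, this.2.symm⟩

/-- The values of `F` at the vertices `v` of the network `N` are determined by the balls of
radius `k` around `v`. -/
def LocalAt (F : Network V κ → V → α) (N : Network V κ) (k : ℕ) : Prop :=
  ∀ v N', Agree N N' k v → F N v = F N' v

theorem LocalAt.mono {F : Network V κ → V → α} (h : LocalAt F N k) (hkl : k ≤ l) :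
    LocalAt F N l := fun v N' hv => h v N' (hv.mono hkl)

theorem degIn_congr {G G' : SimpleGraph V} (B : Finset V) (h : G.Adj u = G'.Adj u) :
    degIn G B u = degIn G' B u := by
  classical
  exact congrArg Finset.card (Finset.filter_congr fun w _ => by rw [h])

end Locality

/-! ### Greedy coloring -/

section Greedy

variable {V κ : Type*} {G : SimpleGraph V} {u v w : V}

/-- The lexicographic comparison of the pairs `(a u, b u)` and `(a v, b v)`. -/
def Earlier (a b : V → ℕ) (u v : V) : Prop := a u < a v ∨ a u = a v ∧ b u < b v

theorem earlier_or_earlier {a b : V → ℕ} (h : b u ≠ b v) : Earlier a b u v ∨ Earlier a b v u := by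
  unfold Earlier
  omega

open Classical in
/-- The coloring in which the vertices are colored in the lexicographic order of the pairs
`(a v, b v)`, every vertex with a color of its list that its earlier neighbors do not have. Where
there is no such color, the value is arbitrary. -/
noncomputable def greedy [Nonempty κ] (G : SimpleGraph V) (a b : V → ℕ) (Λ : V → Finset κ)
    (v : V) : κ :=
  Classical.epsilon fun α => α ∈ Λ v ∧
    ∀ u, G.Adj v u → (h : Earlier a b u v) → greedy G a b Λ u ≠ α
termination_by (a v, b v)
decreasing_by exact Prod.lex_def.2 h

open Classical in
theorem greedy_spec [Fintype V] [Nonempty κ] {a b : V → ℕ} {Λ : V → Finset κ}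
    (h : (Finset.univ.filter fun u => G.Adj v u ∧ Earlier a b u v).card < (Λ v).card) :
    greedy G a b Λ v ∈ Λ v ∧
      ∀ u, G.Adj v u → Earlier a b u v → greedy G a b Λ u ≠ greedy G a b Λ v := by
  have hex : ∃ α, α ∈ Λ v ∧ ∀ u, G.Adj v u → Earlier a b u v → greedy G a b Λ u ≠ α := by
    obtain ⟨α, hα, hn⟩ := Finset.exists_mem_notMem_of_card_lt_card
      (Finset.card_image_le (f := greedy G a b Λ).trans_lt h)
    refine ⟨α, hα, fun u hu hev hg => hn (Finset.mem_image.2 ⟨u, ?_, hg⟩)⟩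
    simp [hu, hev]
  have := Classical.epsilon_spec hex
  rw [greedy]
  exact this

/-- A chain of dependencies that ends in `v` has at most `a v * (β + 1) + b v` steps, if `β` is
an upper bound for `b`. So this number, with the locality of the order and of the lists, gives
the locality of the greedy coloring. Only the network `N` has to satisfy the bound. -/
theorem greedy_congr {κ' : Type*} [Nonempty κ'] {a b : Network V κ → V → ℕ}
    {Λ : Network V κ → V → Finset κ'} {N N' : Network V κ} {k β : ℕ}
    (ha : LocalAt a N k) (hb : LocalAt b N k) (hΛ : LocalAt Λ N k) (hβ : ∀ u, b N u ≤ β)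
    {M : ℕ} (hM : a N v * (β + 1) + b N v ≤ M) (h : Agree N N' (k + 1 + M) v) :
    greedy N.graph (a N) (b N) (Λ N) v = greedy N'.graph (a N') (b N') (Λ N') v := by
  induction M using Nat.strong_induction_on generalizing v with
  | _ M ih =>
    rw [greedy, greedy]
    congr 1
    funext α
    rw [hΛ v N' (h.mono (by omega))]
    refine congrArg _ (forall_congr fun u => ?_)
    rw [← h.adj_iff]
    refine propext (forall_congr' fun hu => ?_)
    have hAu : Agree N N' (k + M) u := h.of_adj hu (by omega)
    have heq : Earlier (a N) (b N) u v ↔ Earlier (a N') (b N') u v := by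
      rw [Earlier, Earlier, ha v N' (h.mono (by omega)), hb v N' (h.mono (by omega)),
        ha u N' (hAu.mono (by omega)), hb u N' (hAu.mono (by omega))]
    have hg : Earlier (a N) (b N) u v → greedy N.graph (a N) (b N) (Λ N) u =
        greedy N'.graph (a N') (b N') (Λ N') u := fun hev => by
      have hlt : a N u * (β + 1) + b N u < a N v * (β + 1) + b N v := by
        rcases hev with hev | ⟨h1, h2⟩
        · have := hβ u
          have := Nat.mul_le_mul_right (β + 1) hev
          rw [Nat.succ_mul] at this
          omega
        · rw [h1]
          omega
      exact ih (M - 1) (by omega) (by omega) (hAu.mono (by omega))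
    exact ⟨fun H hev => hg (heq.2 hev) ▸ H (heq.2 hev), fun H hev => hg hev ▸ H (heq.1 hev)⟩

variable [Fintype V]

/-- Colorings with values at most `d(v)` at every vertex `v`, improved by one bit of the identifiers
after the other: adjacent vertices whose identifiers differ in one of the first `i` bits receive
different colors. In the step from `i` to `i + 1`, the vertices are colored greedily in the
order given by the `i`-th bit and the previous color. -/
noncomputable def bitColor (ident : V → ℕ) : ℕ → Network V κ → V → ℕ
  | 0, _ => fun _ => 0
  | i + 1, N => greedy N.graph (fun v => ((ident v).testBit i).toNat) (bitColor ident i N)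
      fun v => Finset.range (degIn N.graph Finset.univ v + 1)

open Classical in
theorem card_filter_earlier_le (G : SimpleGraph V) (a b : V → ℕ) (v : V) :
    (Finset.univ.filter fun u => G.Adj v u ∧ Earlier a b u v).card ≤ degIn G Finset.univ v :=
  Finset.card_le_card fun u hu => by simpa using (Finset.mem_filter_univ u |>.1 hu).1

theorem bitColor_succ_spec (ident : V → ℕ) (i : ℕ) (N : Network V κ) (v : V) :
    bitColor ident (i + 1) N v ≤ degIn N.graph Finset.univ v ∧
      ∀ u, N.graph.Adj v u → Earlier (fun v => ((ident v).testBit i).toNat)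
        (bitColor ident i N) u v → bitColor ident (i + 1) N u ≠ bitColor ident (i + 1) N v := by
  have := greedy_spec (G := N.graph) (a := fun v => ((ident v).testBit i).toNat)
    (b := bitColor ident i N)
    (Λ := fun v => Finset.range (degIn N.graph Finset.univ v + 1)) (v := v) (by
      rw [Finset.card_range]
      exact Nat.lt_succ_of_le (card_filter_earlier_le _ _ _ _))
  refine ⟨Nat.lt_succ_iff.1 (Finset.mem_range.1 this.1), this.2⟩

theorem bitColor_le (ident : V → ℕ) (i : ℕ) (N : Network V κ) (v : V) :
    bitColor ident i N v ≤ degIn N.graph Finset.univ v := by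
  cases i with
  | zero => exact Nat.zero_le _
  | succ i => exact (bitColor_succ_spec ident i N v).1

theorem bitColor_ne {ident : V → ℕ} {N : Network V κ} (huv : N.graph.Adj u v) {i j : ℕ}
    (hj : j < i) (hb : (ident u).testBit j ≠ (ident v).testBit j) :
    bitColor ident i N u ≠ bitColor ident i N v := by
  induction i with
  | zero => omega
  | succ i ih =>
    have : Earlier (fun v => ((ident v).testBit i).toNat) (bitColor ident i N) u v ∨
        Earlier (fun v => ((ident v).testBit i).toNat) (bitColor ident i N) v u := by
      rcases Nat.lt_succ_iff_lt_or_eq.1 hj with hj | rfl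
      · exact earlier_or_earlier (ih hj)
      · unfold Earlier
        have : ((ident u).testBit j).toNat ≠ ((ident v).testBit j).toNat := by
          intro h
          apply hb
          revert h
          cases (ident u).testBit j <;> cases (ident v).testBit j <;> simp
        dsimp only
        omega
    rcases this with h | h
    · exact (bitColor_succ_spec ident i N v).2 u huv.symm h
    · exact ((bitColor_succ_spec ident i N u).2 v huv h).symm

theorem localAt_bitColor (ident : V → ℕ) {N : Network V κ} {Δ : ℕ}
    (hΔ : ∀ u, degIn N.graph Finset.univ u ≤ Δ) (i : ℕ) :
    LocalAt (bitColor ident i) N (i * (2 * Δ + 2)) := by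
  induction i with
  | zero => exact fun v N' _ => rfl
  | succ i ih =>
    intro v N' h
    rw [Nat.succ_mul] at h
    have hbit := Bool.toNat_le ((ident v).testBit i)
    refine greedy_congr (a := fun _ v => ((ident v).testBit i).toNat) (b := bitColor ident i)
      (Λ := fun N v => Finset.range (degIn N.graph Finset.univ v + 1))
      (k := i * (2 * Δ + 2)) (β := Δ) (M := 2 * Δ + 1) (fun _ _ _ => rfl) ih
      (fun v N' h => ?_) (fun u => (bitColor_le ident i N u).trans (hΔ u)) ?_ (h.mono (by omega))
    · simp only [degIn_congr Finset.univ (h v (Near.refl _ _ _)).1]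
    · have h1 := (bitColor_le ident i N v).trans (hΔ v)
      have h2 := Nat.mul_le_mul_right (Δ + 1) hbit
      omega

end Greedy

/-! ### Ruling sets -/

section Ruling

variable {V κ : Type*} {u v : V}

/-- A set of vertices that is thinned out bit by bit: in step `i`, the vertices whose identifiers
have the `i`-th bit one are deleted if they are within distance `K` of a vertex that is still there
and has this bit zero. -/
def Ruling (ident : V → ℕ) (K : ℕ) : ℕ → Network V κ → V → Prop
  | 0, _ => fun _ => True
  | i + 1, N => fun v => Ruling ident K i N v ∧ ((ident v).testBit i = false ∨
      ∀ u, Near N.graph K v u → Ruling ident K i N u → (ident u).testBit i = true)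

theorem Ruling.of_le {ident : V → ℕ} {K : ℕ} {N : Network V κ} {i j : ℕ} (hij : i ≤ j)
    (h : Ruling ident K j N v) : Ruling ident K i N v := by
  induction hij with
  | refl => exact h
  | step _ ih => exact ih h.1

theorem exists_ruling_near (ident : V → ℕ) (K : ℕ) (N : Network V κ) (v : V) (i : ℕ) :
    ∃ u, Ruling ident K i N u ∧ Near N.graph (i * K) v u := by
  induction i with
  | zero => exact ⟨v, trivial, Near.refl _ _ _⟩
  | succ i ih =>
    obtain ⟨u, hu, hvu⟩ := ih
    rw [Nat.succ_mul]
    by_cases h : Ruling ident K (i + 1) N u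
    · exact ⟨u, h, hvu.mono (by omega)⟩
    · have h' := not_or.1 fun h' => h ⟨hu, h'⟩
      push Not at h'
      obtain ⟨-, w, huw, hw, hb⟩ := h'
      exact ⟨w, ⟨hw, Or.inl (by simpa using hb)⟩, hvu.trans huw⟩

theorem Ruling.eq_of_near {ident : V → ℕ} {K : ℕ} {N : Network V κ} {m : ℕ}
    (hinj : Function.Injective ident) (hm : ∀ v, ident v < 2 ^ m) (hu : Ruling ident K m N u)
    (hv : Ruling ident K m N v) (huv : Near N.graph K u v) : u = v := by
  refine hinj (Nat.eq_of_testBit_eq fun i => ?_)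
  rcases lt_or_ge i m with hi | hi
  · have hu' : Ruling ident K (i + 1) N u := hu.of_le hi
    have hv' : Ruling ident K (i + 1) N v := hv.of_le hi
    have h1 := hu'.2.imp_right fun h => h v huv hv'.1
    have h2 := hv'.2.imp_right fun h => h u huv.symm hu'.1
    grind
  · have hle := Nat.pow_le_pow_right two_pos hi
    rw [Nat.testBit_lt_two_pow ((hm u).trans_le hle), Nat.testBit_lt_two_pow ((hm v).trans_le hle)]

theorem localAt_ruling (ident : V → ℕ) (K : ℕ) (N : Network V κ) (i : ℕ) :
    LocalAt (Ruling ident K i) N (i * K) := by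
  induction i with
  | zero => exact fun _ _ _ => rfl
  | succ i ih =>
    intro v N' h
    rw [Nat.succ_mul] at h
    simp only [Ruling, ih v N' (h.mono (by omega))]
    refine congrArg _ (congrArg _ (forall_congr fun u => ?_))
    rw [← h.near_iff (by omega)]
    refine propext (forall_congr' fun hu => ?_)
    rw [ih u N' (h.of_near hu (by omega))]

end Ruling

/-! ### Flexible sets -/

section Flexible

variable {V κ : Type*} [Fintype V] {N N' : Network V κ} {R m : ℕ} {u v w s : V}

/-- The list-assignment of the network is nice. -/
def Network.IsNice (N : Network V κ) : Prop :=
  ∀ v, degIn N.graph Finset.univ v ≤ (N.list v).card ∧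
    (degIn N.graph Finset.univ v ≤ 2 ∨ N.graph.IsClique (N.graph.neighborSet v) →
      degIn N.graph Finset.univ v + 1 ≤ (N.list v).card)

/-- Every coloring of the vertices outside `B` extends to `B`, in the following sense: the subgraph
induced by `B` is colorable from all lists that can be left when each vertex of `B` loses at
most one color of its list for each of its neighbors outside `B`. -/
def Flexible (N : Network V κ) (B : Finset V) : Prop :=
  ∀ L : V → Finset κ, (∀ u ∈ B, (N.list u).card + degIn N.graph B u ≤
    (L u).card + degIn N.graph Finset.univ u) → ColorableOn N.graph B L

theorem Flexible.congr {B : Finset V}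
    (h : ∀ u ∈ B, N.graph.Adj u = N'.graph.Adj u ∧ N.list u = N'.list u) (hB : Flexible N B) :
    Flexible N' B := by
  intro L hL
  obtain ⟨c, hc, hp⟩ := hB L fun u hu => by
    rw [degIn_congr B (h u hu).1, degIn_congr Finset.univ (h u hu).1, (h u hu).2]
    exact hL u hu
  exact ⟨c, hc, fun u hu w hw huw => hp u hu w hw (by rwa [(h u hu).1])⟩

theorem flexible_singleton (h : degIn N.graph Finset.univ v + 1 ≤ (N.list v).card) :
    Flexible N {v} := by
  intro L hL
  have := hL v (Finset.mem_singleton_self v)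
  obtain ⟨α, hα⟩ := Finset.card_pos.1 (show 0 < (L v).card by omega)
  refine ⟨fun _ => α, fun u hu => ?_, fun u hu w hw huw => ?_⟩
  · rwa [Finset.mem_singleton.1 hu]
  · rw [Finset.mem_singleton.1 hu, Finset.mem_singleton.1 hw] at huw
    exact (N.graph.loopless.irrefl _ huw).elim

/-- In a nice network, there is a flexible set in every ball of logarithmic radius. -/
theorem Network.IsNice.exists_flexible (hN : N.IsNice) (hm : Fintype.card V < 2 ^ m) (v : V) :
    ∃ B : Finset V, B.Nonempty ∧ (∀ u ∈ B, Near N.graph (2 * m + 1) v u) ∧ Flexible N B := by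
  classical
  by_contra hno
  push Not at hno
  have near : ∀ {u}, (∃ s ≤ 2 * m + 1, Level N.graph v s u) → Near N.graph (2 * m + 1) v u := by
    rintro u ⟨s, hs, hu, hd⟩
    obtain ⟨p, hp⟩ := hu.exists_walk_length_eq_dist
    exact ⟨p, by omega⟩
  refine not_regularBall (G := N.graph) (v := v) hm (fun x s hs hx => ?_) fun B hne hB h2 => ?_
  · have hlt : ¬ degIn N.graph Finset.univ x + 1 ≤ (N.list x).card := fun h =>
      hno {x} (Finset.singleton_nonempty x)
        (fun u hu => near ⟨s, hs, (Finset.mem_singleton.1 hu).symm ▸ hx⟩) (flexible_singleton h)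
    have h := not_or.1 (mt (hN x).2 hlt)
    refine ⟨by omega, ?_⟩
    have h' := h.2
    simp only [SimpleGraph.IsClique, Set.Pairwise, SimpleGraph.mem_neighborSet] at h'
    push Not at h'
    obtain ⟨a, ha, b, hb, hab, hn⟩ := h'
    exact ⟨a, b, ha, hb, hab, hn⟩
  · obtain ⟨z, hz⟩ := hne
    refine h2.regular_of_not_degreeChoosable (κ := κ) hz fun hch => ?_
    refine hno B ⟨z, hz⟩ (fun u hu => near (hB u hu)) fun L hL => hch L fun u hu => ?_
    have := hL u hu
    have := (hN u).1
    omega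

/-- A nonempty flexible set in the ball of radius `R` around `s`, if there is one. Otherwise, the
value is arbitrary. -/
noncomputable def flexSet (N : Network V κ) (R : ℕ) (s : V) : Finset V :=
  Classical.epsilon fun B : Finset V => B.Nonempty ∧ (∀ u ∈ B, Near N.graph R s u) ∧ Flexible N B

theorem Network.IsNice.flexSet_spec (hN : N.IsNice) (hm : Fintype.card V < 2 ^ m) (s : V) :
    (flexSet N (2 * m + 1) s).Nonempty ∧
      (∀ u ∈ flexSet N (2 * m + 1) s, Near N.graph (2 * m + 1) s u) ∧
      Flexible N (flexSet N (2 * m + 1) s) :=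
  Classical.epsilon_spec (hN.exists_flexible hm s)

theorem Agree.flexSet_eq (h : Agree N N' R s) : flexSet N R s = flexSet N' R s := by
  refine congrArg Classical.epsilon (funext fun B => congrArg _ (propext ?_))
  constructor
  · rintro ⟨h1, h2⟩
    exact ⟨fun u hu => (h.near_iff le_rfl).1 (h1 u hu), h2.congr fun u hu => h u (h1 u hu)⟩
  · rintro ⟨h1, h2⟩
    exact ⟨fun u hu => (h.near_iff le_rfl).2 (h1 u hu),
      h2.congr fun u hu => h.symm u (h1 u hu)⟩

end Flexible

/-! ### The coloring and its locality -/

section Coloring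

variable {V κ : Type*} [Fintype V] {N N' : Network V κ} {m : ℕ} {u v w s : V}
  {ident : V → ℕ}

/-- The vertex `v` lies in the flexible set of the vertex `s` of the ruling set. The flexible sets
have radius `2 * m + 1`, so that the distance `4 * m + 3` in the ruling set keeps them disjoint and
without edges between them. The last condition is automatic in nice networks; in other ones, where
`flexSet` may be arbitrary, it keeps the definition local. -/
def InCore (ident : V → ℕ) (m : ℕ) (N : Network V κ) (s v : V) : Prop :=
  Ruling ident (4 * m + 3) m N s ∧ v ∈ flexSet N (2 * m + 1) s ∧ Near N.graph (2 * m + 1) s v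

/-- A bound for the distance of a vertex from the flexible sets around the ruling set. -/
def coreDist (m : ℕ) : ℕ := m * (4 * m + 3) + (2 * m + 1)

open Classical in
/-- The number of radii `j < coreDist m` such that the ball of radius `j` around `v` meets the
flexible sets around the ruling set. It grows from `0` to `coreDist m` on the way to these sets. -/
noncomputable def proximity (ident : V → ℕ) (m : ℕ) (N : Network V κ) (v : V) : ℕ :=
  ((Finset.range (coreDist m)).filter fun j =>
    ∃ u, Near N.graph j v u ∧ ∃ s, InCore ident m N s u).card

/-- The greedy coloring towards the flexible sets, with ties broken by a proper coloring. -/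
noncomputable def outerColor [Nonempty κ] (ident : V → ℕ) (m : ℕ) (N : Network V κ) : V → κ :=
  greedy N.graph (proximity ident m N) (bitColor ident m N) N.list

/-- A coloring of the flexible set of `s` that extends the outer coloring. -/
noncomputable def innerColor [Nonempty κ] (ident : V → ℕ) (m : ℕ) (N : Network V κ) (s : V) :
    V → κ :=
  Classical.epsilon fun c : V → κ => ∀ u ∈ flexSet N (2 * m + 1) s, Near N.graph (2 * m + 1) s u →
    c u ∈ N.list u ∧ ∀ w, N.graph.Adj u w → (w ∈ flexSet N (2 * m + 1) s → c u ≠ c w) ∧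
      (w ∉ flexSet N (2 * m + 1) s → c u ≠ outerColor ident m N w)

open Classical in
/-- The coloring of a nice network: the outer coloring, replaced by the inner colorings on the
flexible sets around the ruling set. -/
noncomputable def listColor [Nonempty κ] (ident : V → ℕ) (m : ℕ) (N : Network V κ) (v : V) : κ :=
  if ∃ s, InCore ident m N s v then
    innerColor ident m N (@Classical.epsilon V ⟨v⟩ fun s => InCore ident m N s v) v
  else outerColor ident m N v

theorem InCore.near (h : InCore ident m N s v) : Near N.graph (2 * m + 1) s v := h.2.2

theorem Network.IsNice.exists_inCore (hN : N.IsNice) (hm : Fintype.card V < 2 ^ m) (v : V) :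
    ∃ u, Near N.graph (coreDist m) v u ∧ ∃ s, InCore ident m N s u := by
  obtain ⟨s, hs, hvs⟩ := exists_ruling_near ident (4 * m + 3) N v m
  obtain ⟨⟨u, hu⟩, hnear, -⟩ := hN.flexSet_spec hm s
  exact ⟨u, hvs.trans (hnear u hu), s, hs, hu, hnear u hu⟩

theorem proximity_le (ident : V → ℕ) (m : ℕ) (N : Network V κ) (v : V) :
    proximity ident m N v ≤ coreDist m := by
  classical
  exact (Finset.card_filter_le _ _).trans_eq (Finset.card_range _)

/-- Outside of the flexible sets, some neighbor is closer to them. -/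
theorem Network.IsNice.exists_proximity_lt (hN : N.IsNice) (hm : Fintype.card V < 2 ^ m)
    (hv : ¬ ∃ s, InCore ident m N s v) :
    ∃ w, N.graph.Adj v w ∧ proximity ident m N v < proximity ident m N w := by
  classical
  let P : ℕ → V → Prop := fun j v => ∃ u, Near N.graph j v u ∧ ∃ s, InCore ident m N s u
  have hex : ∃ j, P j v := ⟨coreDist m, hN.exists_inCore hm v⟩
  have hle : Nat.find hex ≤ coreDist m := Nat.find_min' hex (hN.exists_inCore hm v)
  obtain ⟨u, hvu, hu⟩ := Nat.find_spec hex
  obtain ⟨j, hj⟩ : ∃ j, Nat.find hex = j + 1 := by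
    refine ⟨Nat.find hex - 1, ?_⟩
    have : Nat.find hex ≠ 0 := fun h => by
      rw [h, near_zero_iff] at hvu
      exact hv (hvu ▸ hu)
    omega
  rw [hj, near_succ_iff] at hvu
  rcases hvu with rfl | ⟨w, hvw, hwu⟩
  · exact (hv hu).elim
  refine ⟨w, hvw, Finset.card_lt_card ⟨fun i hi => ?_, fun hsub => ?_⟩⟩
  · rw [Finset.mem_filter] at hi ⊢
    have := Nat.find_min' hex hi.2
    exact ⟨hi.1, u, hwu.mono (by omega), hu⟩
  · have hmem := hsub (Finset.mem_filter.2 ⟨Finset.mem_range.2 (show j < _ by omega),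
      u, hwu, hu⟩)
    have := Nat.find_min' hex (Finset.mem_filter.1 hmem).2
    omega

theorem Network.IsNice.outerColor_spec [Nonempty κ] (hN : N.IsNice)
    (hm : Fintype.card V < 2 ^ m) (hv : ¬ ∃ s, InCore ident m N s v) :
    outerColor ident m N v ∈ N.list v ∧ ∀ u, N.graph.Adj v u →
      Earlier (proximity ident m N) (bitColor ident m N) u v →
      outerColor ident m N u ≠ outerColor ident m N v := by
  classical
  refine greedy_spec (lt_of_lt_of_le ?_ (hN v).1)
  obtain ⟨w, hvw, hw⟩ := hN.exists_proximity_lt hm hv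
  refine Finset.card_lt_card ⟨fun u hu => ?_, fun hsub => ?_⟩
  · simpa using (Finset.mem_filter_univ u |>.1 hu).1
  · have := hsub (Finset.mem_filter.2 ⟨Finset.mem_univ w, hvw⟩)
    have := (Finset.mem_filter_univ w |>.1 this).2
    unfold Earlier at this
    omega

theorem Network.IsNice.innerColor_spec [Nonempty κ] (hN : N.IsNice)
    (hm : Fintype.card V < 2 ^ m) (s : V) (hu : u ∈ flexSet N (2 * m + 1) s) :
    innerColor ident m N s u ∈ N.list u ∧ ∀ w, N.graph.Adj u w →
      (w ∈ flexSet N (2 * m + 1) s → innerColor ident m N s u ≠ innerColor ident m N s w) ∧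
      (w ∉ flexSet N (2 * m + 1) s → innerColor ident m N s u ≠ outerColor ident m N w) := by
  classical
  obtain ⟨-, hnear, hflex⟩ := hN.flexSet_spec hm s
  set B := flexSet N (2 * m + 1) s with hB
  have key : ∃ c : V → κ, ∀ u ∈ B, Near N.graph (2 * m + 1) s u → c u ∈ N.list u ∧
      ∀ w, N.graph.Adj u w → (w ∈ B → c u ≠ c w) ∧ (w ∉ B → c u ≠ outerColor ident m N w) := by
    obtain ⟨c, hc, hp⟩ := hflex (fun u => N.list u \
      (Finset.univ.filter fun w => N.graph.Adj u w ∧ w ∉ B).image (outerColor ident m N))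
      fun u hu => by
        have h1 := Finset.le_card_sdiff ((Finset.univ.filter fun w => N.graph.Adj u w ∧
          w ∉ B).image (outerColor ident m N)) (N.list u)
        have h2 := Finset.card_image_le (f := outerColor ident m N)
          (s := Finset.univ.filter fun w => N.graph.Adj u w ∧ w ∉ B)
        have h3 : degIn N.graph B u + (Finset.univ.filter fun w => N.graph.Adj u w ∧ w ∉ B).card ≤
            degIn N.graph Finset.univ u := by
          unfold degIn
          rw [← Finset.card_union_of_disjoint]
          · refine Finset.card_le_card fun w hw => ?_
            simp only [Finset.mem_union, Finset.mem_filter, Finset.mem_univ, true_and] at hw ⊢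
            tauto
          · rw [Finset.disjoint_left]
            intro w hw hw'
            simp only [Finset.mem_filter, Finset.mem_univ, true_and] at hw hw'
            exact hw'.2 hw.1
        omega
    refine ⟨c, fun u hu _ => ⟨(Finset.mem_sdiff.1 (hc u hu)).1, fun w hw => ?_⟩⟩
    refine ⟨fun hwB => hp u hu w hwB hw, fun hwB h => ?_⟩
    · refine (Finset.mem_sdiff.1 (hc u hu)).2 (Finset.mem_image.2 ⟨w, ?_, h.symm⟩)
      simp [hw, hwB]
  exact Classical.epsilon_spec key u hu (hnear u hu)

theorem InCore.eq_of_adj (hinj : Function.Injective ident) (hid : ∀ v, ident v < 2 ^ m)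
    {s' : V} (hu : InCore ident m N s u) (hw : InCore ident m N s' w) (huw : N.graph.Adj u w) :
    s = s' :=
  hu.1.eq_of_near hinj hid hw.1
    (((hu.near.trans (near_of_adj huw)).trans hw.near.symm).mono (by omega))

theorem InCore.listColor_eq [Nonempty κ] (hinj : Function.Injective ident)
    (hid : ∀ v, ident v < 2 ^ m) (h : InCore ident m N s v) :
    listColor ident m N v = innerColor ident m N s v := by
  have hex : ∃ s, InCore ident m N s v := ⟨s, h⟩
  rw [listColor, if_pos hex]
  have hs := @Classical.epsilon_spec V (fun s => InCore ident m N s v) hex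
  rw [hs.1.eq_of_near hinj hid h.1 ((hs.near.trans h.near.symm).mono (by omega))]

theorem Network.IsNice.listColor_spec [Nonempty κ] (hN : N.IsNice)
    (hm : Fintype.card V < 2 ^ m) (hinj : Function.Injective ident) (hid : ∀ v, ident v < 2 ^ m) :
    (∀ v, listColor ident m N v ∈ N.list v) ∧
      ∀ u v, N.graph.Adj u v → listColor ident m N u ≠ listColor ident m N v := by
  have inner : ∀ {s v}, InCore ident m N s v →
      listColor ident m N v = innerColor ident m N s v :=
    fun h => h.listColor_eq hinj hid
  have outer : ∀ {v}, ¬ (∃ s, InCore ident m N s v) →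
      listColor ident m N v = outerColor ident m N v := fun h => if_neg h
  have mixed : ∀ {s u v}, InCore ident m N s u → ¬ (∃ s, InCore ident m N s v) →
      N.graph.Adj u v → listColor ident m N u ≠ listColor ident m N v := by
    intro s u v hu hv huv
    rw [inner hu, outer hv]
    exact ((hN.innerColor_spec hm s hu.2.1).2 v huv).2 fun hvB =>
      hv ⟨s, hu.1, hvB, (hN.flexSet_spec hm s).2.1 v hvB⟩
  refine ⟨fun v => ?_, fun u v huv => ?_⟩
  · by_cases hv : ∃ s, InCore ident m N s v
    · obtain ⟨s, hs⟩ := hv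
      rw [inner hs]
      exact (hN.innerColor_spec hm s hs.2.1).1
    · rw [outer hv]
      exact (hN.outerColor_spec hm hv).1
  · by_cases hu : ∃ s, InCore ident m N s u <;> by_cases hv : ∃ s, InCore ident m N s v
    · obtain ⟨s, hs⟩ := hu
      obtain ⟨s', hs'⟩ := hv
      obtain rfl := hs.eq_of_adj hinj hid hs' huv
      rw [inner hs, inner hs']
      exact ((hN.innerColor_spec hm s hs.2.1).2 v huv).1 hs'.2.1
    · obtain ⟨s, hs⟩ := hu
      exact mixed hs hv huv
    · obtain ⟨s, hs⟩ := hv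
      exact (mixed hs hu huv.symm).symm
    · rw [outer hu, outer hv]
      -- the identifiers differ in one of the first `m` bits
      obtain ⟨i, hi⟩ : ∃ i, (ident u).testBit i ≠ (ident v).testBit i := by
        by_contra h
        push Not at h
        exact huv.ne (hinj (Nat.eq_of_testBit_eq h))
      have him : i < m := by
        by_contra h
        have hle := Nat.pow_le_pow_right two_pos (not_lt.1 h)
        rw [Nat.testBit_lt_two_pow ((hid u).trans_le hle),
          Nat.testBit_lt_two_pow ((hid v).trans_le hle)] at hi
        exact hi rfl
      rcases earlier_or_earlier (a := proximity ident m N) (bitColor_ne huv him hi) with h | h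
      · exact (hN.outerColor_spec hm hv).2 u huv.symm h
      · exact ((hN.outerColor_spec hm hu).2 v huv h).symm

theorem Agree.inCore_iff (h : Agree N N' (coreDist m) s) :
    InCore ident m N s v ↔ InCore ident m N' s v := by
  unfold coreDist at h
  rw [InCore, InCore, localAt_ruling ident (4 * m + 3) N m s N' (h.mono (by omega)),
    (h.mono (by omega) : Agree N N' (2 * m + 1) s).flexSet_eq, h.near_iff (by omega)]

theorem Agree.inCore_iff_of_near (h : Agree N N' (2 * m + 1 + coreDist m) v) :
    InCore ident m N s v ↔ InCore ident m N' s v :=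
  ⟨fun hs => (h.of_near hs.near.symm le_rfl).inCore_iff.1 hs,
    fun hs => (h.symm.of_near hs.near.symm le_rfl).inCore_iff.1 hs⟩

theorem localAt_proximity (ident : V → ℕ) (m : ℕ) (N : Network V κ) :
    LocalAt (proximity ident m) N (2 * coreDist m + (2 * m + 1)) := by
  classical
  intro v N' h
  refine congrArg Finset.card (Finset.filter_congr fun j hj => exists_congr fun u => ?_)
  have hj := Finset.mem_range.1 hj
  rw [← h.near_iff (by omega)]
  exact and_congr_right fun hu => exists_congr fun s =>
    (h.of_near hu (by omega)).inCore_iff_of_near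

/-- The radius that determines the outer coloring, for the maximum degree `Δ`. -/
def outerRadius (m Δ : ℕ) : ℕ :=
  2 * coreDist m + (2 * m + 1) + m * (2 * Δ + 2) + 1 + (coreDist m * (Δ + 1) + Δ)

theorem localAt_outerColor [Nonempty κ] (ident : V → ℕ) (m : ℕ) {N : Network V κ} {Δ : ℕ}
    (hΔ : ∀ u, degIn N.graph Finset.univ u ≤ Δ) :
    LocalAt (outerColor ident m) N (outerRadius m Δ) := by
  intro v N' h
  have hb : ∀ u, bitColor ident m N u ≤ Δ := fun u => (bitColor_le ident m N u).trans (hΔ u)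
  exact greedy_congr (a := proximity ident m) (b := bitColor ident m) (Λ := Network.list)
    ((localAt_proximity ident m N).mono (Nat.le_add_right _ _))
    ((localAt_bitColor ident hΔ m).mono (Nat.le_add_left _ _)) (fun _ _ h => h.list_eq) hb
    (add_le_add (Nat.mul_le_mul_right _ (proximity_le ident m N v)) (hb v)) h

theorem Agree.innerColor_eq [Nonempty κ] {Δ : ℕ}
    (hΔ : ∀ u, degIn N.graph Finset.univ u ≤ Δ)
    (h : Agree N N' (2 * m + 1 + (1 + outerRadius m Δ)) s) :
    innerColor ident m N s = innerColor ident m N' s := by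
  unfold innerColor
  rw [(h.mono (by omega) : Agree N N' (2 * m + 1) s).flexSet_eq]
  refine congrArg Classical.epsilon (funext fun c => forall_congr fun u => forall_congr fun _ => ?_)
  rw [← h.near_iff (by omega)]
  refine propext (forall_congr' fun hu => ?_)
  have hAu : Agree N N' (1 + outerRadius m Δ) u := h.of_near hu le_rfl
  rw [hAu.list_eq]
  refine and_congr_right fun _ => forall_congr' fun w => ?_
  rw [← hAu.adj_iff]
  refine forall_congr' fun hw => ?_
  rw [localAt_outerColor ident m hΔ w N' (hAu.of_adj hw (by omega))]

/-- The radius that determines the coloring, for the maximum degree `Δ`. -/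
def colorRadius (m Δ : ℕ) : ℕ := 2 * (2 * m + 1) + 1 + outerRadius m Δ

theorem localAt_listColor [Nonempty κ] (ident : V → ℕ) (m : ℕ) {N : Network V κ} {Δ : ℕ}
    (hΔ : ∀ u, degIn N.graph Finset.univ u ≤ Δ) :
    LocalAt (listColor ident m) N (colorRadius m Δ) := by
  intro v N' h
  unfold colorRadius at h
  have hcore : (fun s => InCore ident m N s v) = fun s => InCore ident m N' s v := by
    funext s
    refine propext (h.mono ?_).inCore_iff_of_near
    unfold outerRadius
    omega
  by_cases hex : ∃ s, InCore ident m N s v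
  · have hs := @Classical.epsilon_spec V (fun s => InCore ident m N s v) hex
    have hex' : ∃ s, InCore ident m N' s v := hex.imp fun s hs => (congrFun hcore s) ▸ hs
    rw [listColor, listColor, if_pos hex, if_pos hex', ← hcore,
      (h.of_near hs.near.symm (by omega)).innerColor_eq hΔ]
  · have hex' : ¬ ∃ s, InCore ident m N' s v :=
      fun h' => hex (h'.imp fun s hs => (congrFun hcore s).symm ▸ hs)
    rw [listColor, listColor, if_neg hex, if_neg hex',
      localAt_outerColor ident m hΔ v N' (h.mono (by omega))]

theorem colorRadius_succ_le {m Δ : ℕ} (hm : 2 ≤ m) :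
    colorRadius m Δ + 1 ≤ 100 * (max Δ 1 ^ 2 * m ^ 3) := by
  unfold colorRadius outerRadius coreDist
  have hΔ : Δ ≤ max Δ 1 := le_max_left _ _
  have hD : 1 ≤ max Δ 1 := le_max_right _ _
  generalize max Δ 1 = D at hΔ hD
  -- all terms are bounded by multiples of `m ^ 2 * D`
  have h1 : m * (4 * m + 3) + (2 * m + 1) ≤ 7 * m ^ 2 := by nlinarith
  have hE : m ^ 2 * D ≤ D ^ 2 * m ^ 3 := by
    rw [mul_comm]
    exact Nat.mul_le_mul (Nat.le_self_pow two_ne_zero D) (Nat.pow_le_pow_right (by omega) (by omega))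
  have h2 : m ^ 2 ≤ m ^ 2 * D := Nat.le_mul_of_pos_right _ hD
  have h3 : m ≤ m ^ 2 := Nat.le_self_pow two_ne_zero m
  have h4 : D ≤ m ^ 2 * D := Nat.le_mul_of_pos_left _ (by positivity)
  have h5 : (m * (4 * m + 3) + (2 * m + 1)) * (Δ + 1) ≤ 7 * m ^ 2 * (2 * D) :=
    Nat.mul_le_mul h1 (by omega)
  have h6 : m * (2 * Δ + 2) ≤ m ^ 2 * (4 * D) := Nat.mul_le_mul h3 (by omega)
  have h7 : 7 * m ^ 2 * (2 * D) = 14 * (m ^ 2 * D) := by ring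
  have h8 : m ^ 2 * (4 * D) = 4 * (m ^ 2 * D) := by ring
  omega

end Coloring

/-! ### Gathering information until the output is determined -/

section Gathering

/-- The knowledge of a node: the number of nodes of the network, its own identifier and list, and a
set of facts about nodes of the network, each consisting of the identifier of a node, the
identifiers of its neighbors, and its list. -/
structure Knowledge (κ : Type) where
  /-- The number of nodes. -/
  card : ℕ
  /-- The own identifier. -/
  ident : ℕ
  /-- The own list. -/
  list : Finset κ
  /-- The known facts. -/
  facts : Set (ℕ × Set ℕ × Finset κ)

variable {κ : Type} {n : ℕ}

/-- The fact `f` holds in the network `N`, in which the vertex `y` has the identifier `y + 1`. -/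
def Network.Satisfies (N : Network (Fin n) κ) (f : ℕ × Set ℕ × Finset κ) : Prop :=
  ∀ y : Fin n, (y : ℕ) + 1 = f.1 →
    N.list y = f.2.2 ∧ ∀ z : Fin n, N.graph.Adj y z ↔ (z : ℕ) + 1 ∈ f.2.1

/-- It is possible, as far as a node with the knowledge `s` can tell, that the network is `N` and
that the node is the vertex `x` of `N`. -/
def Knowledge.Consistent (s : Knowledge κ) (N : Network (Fin n) κ) (x : Fin n) : Prop :=
  n = s.card ∧ (x : ℕ) + 1 = s.ident ∧ N.list x = s.list ∧ ∀ f ∈ s.facts, N.Satisfies f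

/-- The knowledge after a round in which the identifiers and the facts of the neighbors arrive. -/
def Knowledge.update (s : Knowledge κ) (ms : Multiset (ℕ × Set (ℕ × Set ℕ × Finset κ))) :
    Knowledge κ :=
  { s with facts := insert (s.ident, {i | ∃ a ∈ ms, a.1 = i}, s.list) {f | ∃ a ∈ ms, f ∈ a.2} }

open Classical in
/-- The algorithm in which the nodes spread all that they know, and choose an output once the
function `col` has the same value at all networks and vertices that are consistent with
their knowledge. -/
noncomputable def gather (col : ∀ n, Network (Fin n) κ → Fin n → κ) :
    LocalAlgorithm (Finset κ) κ where
  State := Knowledge κ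
  Msg := ℕ × Set (ℕ × Set ℕ × Finset κ)
  init n i L := ⟨n, i, L, ∅⟩
  send s := (s.ident, s.facts)
  receive := Knowledge.update
  output s :=
    if h : ∃ o, ∀ (n : ℕ) (N : Network (Fin n) κ) (x : Fin n), s.Consistent N x → col n N x = o
    then some h.choose else none

/-- The network on `Fin n` that is the image of a graph with lists under the numbering `e`. -/
def Network.ofEquiv {V : Type} (e : V ≃ Fin n) (G : SimpleGraph V) (L : V → Finset κ) :
    Network (Fin n) κ :=
  ⟨G.comap e.symm, fun x => L (e.symm x)⟩

variable {V : Type} [Fintype V] {G : SimpleGraph V} [DecidableRel G.Adj] {ident : V → ℕ}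
  {L : V → Finset κ} {col : ∀ n, Network (Fin n) κ → Fin n → κ}

theorem IsIdentifierAssignment.exists_equiv (h : IsIdentifierAssignment ident) :
    ∃ e : V ≃ Fin (Fintype.card V), ∀ v, (e v : ℕ) + 1 = ident v := by
  let f : V → Fin (Fintype.card V) := fun v =>
    ⟨ident v - 1, by have := h.2 v; omega⟩
  have hf : Function.Bijective f := by
    refine (Fintype.bijective_iff_injective_and_card f).2 ⟨fun u v huv => h.1 ?_, by simp⟩
    have h1 := h.2 u
    have h2 := h.2 v
    have h3 : ident u - 1 = ident v - 1 := congrArg Fin.val huv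
    omega
  refine ⟨Equiv.ofBijective f hf, fun v => ?_⟩
  have := h.2 v
  change ident v - 1 + 1 = ident v
  omega

/-- The knowledge of the node `v` after `t` rounds. -/
def knowledgeAt (G : SimpleGraph V) [DecidableRel G.Adj] (ident : V → ℕ) (L : V → Finset κ) :
    ℕ → V → Knowledge κ
  | 0, v => ⟨Fintype.card V, ident v, L v, ∅⟩
  | t + 1, v => (knowledgeAt G ident L t v).update ((G.neighborFinset v).val.map fun w =>
      ((knowledgeAt G ident L t w).ident, (knowledgeAt G ident L t w).facts))

theorem gather_state (t : ℕ) (v : V) :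
    (gather col).state G ident L t v = knowledgeAt G ident L t v := by
  induction t generalizing v with
  | zero => rfl
  | succ t ih =>
    simp only [LocalAlgorithm.state, ih]
    rfl

theorem knowledgeAt_spec (t : ℕ) (v : V) :
    (knowledgeAt G ident L t v).card = Fintype.card V ∧
      (knowledgeAt G ident L t v).ident = ident v ∧ (knowledgeAt G ident L t v).list = L v := by
  induction t with
  | zero => exact ⟨rfl, rfl, rfl⟩
  | succ t ih => exact ih

theorem mem_facts_succ_iff (t : ℕ) (v : V) (f : ℕ × Set ℕ × Finset κ) :
    f ∈ (knowledgeAt G ident L (t + 1) v).facts ↔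
      f = (ident v, {i | ∃ w, G.Adj v w ∧ ident w = i}, L v) ∨
        ∃ w, G.Adj v w ∧ f ∈ (knowledgeAt G ident L t w).facts := by
  simp only [knowledgeAt, Knowledge.update, knowledgeAt_spec t, Set.mem_insert_iff,
    Multiset.mem_map, Finset.mem_val, SimpleGraph.mem_neighborFinset, Set.mem_ofPred_eq,
    exists_exists_and_eq_and]

variable {e : V ≃ Fin (Fintype.card V)}

theorem consistent_ofEquiv (he : ∀ v, (e v : ℕ) + 1 = ident v)
    (t : ℕ) (v : V) :
    (knowledgeAt G ident L t v).Consistent (Network.ofEquiv e G L) (e v) := by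
  obtain ⟨h1, h2, h3⟩ := knowledgeAt_spec (G := G) (ident := ident) (L := L) t v
  refine ⟨h1.symm, by rw [h2, he], by rw [h3]; simp [Network.ofEquiv], ?_⟩
  clear h1 h2 h3
  induction t generalizing v with
  | zero => intro f hf; exact hf.elim
  | succ t ih =>
    intro f hf
    rw [mem_facts_succ_iff] at hf
    rcases hf with rfl | ⟨w, -, hf⟩
    · intro y hy
      obtain rfl : y = e v := Fin.ext (by have := he v; dsimp only at hy; omega)
      refine ⟨by simp [Network.ofEquiv], fun z => ?_⟩
      simp only [Network.ofEquiv, SimpleGraph.comap_adj, Equiv.symm_apply_apply, Set.mem_ofPred_eq]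
      refine ⟨fun h => ⟨_, h, by rw [← he, Equiv.apply_symm_apply]⟩, ?_⟩
      rintro ⟨w, hw, hz⟩
      rw [← he w] at hz
      rwa [← show e w = z from Fin.ext (by omega), Equiv.symm_apply_apply]
    · exact ih w f hf

theorem fact_mem_facts {t : ℕ} {v : V} {y : Fin (Fintype.card V)}
    (h : Near (Network.ofEquiv e G L).graph t (e v) y) :
    (ident (e.symm y), {i | ∃ w, G.Adj (e.symm y) w ∧ ident w = i}, L (e.symm y)) ∈
      (knowledgeAt G ident L (t + 1) v).facts := by
  induction t generalizing v with
  | zero =>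
    rw [near_zero_iff] at h
    subst h
    rw [mem_facts_succ_iff, Equiv.symm_apply_apply]
    exact Or.inl rfl
  | succ t ih =>
    rw [mem_facts_succ_iff]
    rw [near_succ_iff] at h
    rcases h with rfl | ⟨w, hw, h⟩
    · rw [Equiv.symm_apply_apply]
      exact Or.inl rfl
    · obtain ⟨w, rfl⟩ := e.surjective w
      refine Or.inr ⟨w, ?_, ih h⟩
      simpa [Network.ofEquiv] using hw

theorem agree_of_consistent (he : ∀ v, (e v : ℕ) + 1 = ident v)
    {t : ℕ} {v : V} {N : Network (Fin (Fintype.card V)) κ}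
    {x : Fin (Fintype.card V)}
    (h : (knowledgeAt G ident L (t + 1) v).Consistent N x) :
    Agree (Network.ofEquiv e G L) N t (e v) := by
  intro y hy
  obtain ⟨h1, h2⟩ := h.2.2.2 _ (fact_mem_facts hy) y (by rw [← he, Equiv.apply_symm_apply])
  refine ⟨?_, h1.symm⟩
  funext z
  refine propext (Iff.trans ?_ (h2 z).symm)
  simp only [Network.ofEquiv, SimpleGraph.comap_adj, Set.mem_ofPred_eq]
  refine ⟨fun h => ⟨_, h, by rw [← he, Equiv.apply_symm_apply]⟩, ?_⟩
  rintro ⟨w, hw, hz⟩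
  rw [← he w] at hz
  rwa [← show e w = z from Fin.ext (by omega), Equiv.symm_apply_apply]

/-- Every node outputs the value of `col` for the actual network, as soon as its knowledge
determines this value. -/
theorem exists_chooses (he : ∀ v, (e v : ℕ) + 1 = ident v)
    {T : ℕ} {v : V}
    (hT : ∀ (N : Network (Fin (Fintype.card V)) κ) (x : Fin (Fintype.card V)),
      (knowledgeAt G ident L T v).Consistent N x →
        col _ N x = col _ (Network.ofEquiv e G L) (e v)) :
    ∃ t ≤ T, (gather col).Chooses G ident L v t (col _ (Network.ofEquiv e G L) (e v)) := by
  classical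
  let out : ℕ → Option κ := fun t => (gather col).output (knowledgeAt G ident L t v)
  have hsome : ∀ t, out t ≠ none → out t = some (col _ (Network.ofEquiv e G L) (e v)) := by
    intro t ht
    simp only [out, gather] at ht ⊢
    split_ifs at ht ⊢ with h
    · exact congrArg some (h.choose_spec _ _ _ (consistent_ofEquiv he t v)).symm
    · exact (ht rfl).elim
  have hout : out T ≠ none := by
    have hex : ∃ o, ∀ (n : ℕ) (N : Network (Fin n) κ) (x : Fin n),
        (knowledgeAt G ident L T v).Consistent N x → col n N x = o := by
      refine ⟨col _ (Network.ofEquiv e G L) (e v), fun n N x h => ?_⟩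
      obtain rfl : n = Fintype.card V := h.1.trans (knowledgeAt_spec T v).1
      exact hT N x h
    change dite _ _ _ ≠ none
    rw [dif_pos hex]
    exact Option.some_ne_none _
  have hfind : ∃ t, out t ≠ none := ⟨T, hout⟩
  refine ⟨Nat.find hfind, Nat.find_min' hfind hout, ?_, fun s hs => ?_⟩
  · rw [gather_state]
    exact hsome _ (Nat.find_spec hfind)
  · rw [gather_state]
    exact not_not.1 (Nat.find_min hfind hs)

theorem degIn_ofEquiv (e : V ≃ Fin n) (v : V) :
    degIn (Network.ofEquiv e G L).graph Finset.univ (e v) = G.degree v := by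
  classical
  rw [← G.card_neighborFinset_eq_degree, ← Finset.card_map e.toEmbedding]
  refine congrArg Finset.card (Finset.ext fun x => ?_)
  obtain ⟨w, rfl⟩ := e.surjective x
  simp [Network.ofEquiv]

theorem IsNiceListAssignment.isNice_ofEquiv (h : IsNiceListAssignment G L) (e : V ≃ Fin n) :
    (Network.ofEquiv e G L).IsNice := by
  intro x
  obtain ⟨v, rfl⟩ := e.surjective x
  rw [degIn_ofEquiv]
  have hl : (Network.ofEquiv e G L).list (e v) = L v := by simp [Network.ofEquiv]
  rw [hl]
  refine ⟨(h v).1, fun hv => (h v).2 (hv.imp_right fun hc a ha b hb hab => ?_)⟩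
  have := @hc (e a) (by simpa [Network.ofEquiv] using ha) (e b)
    (by simpa [Network.ofEquiv] using hb) (fun h => hab (e.injective h))
  simpa [Network.ofEquiv] using this

theorem log_two_add_one_le {n : ℕ} (hn : 2 ≤ n) :
    ((Nat.log 2 n + 1 : ℕ) : ℝ) ≤ 3 * Real.log n := by
  have h1 : 1 ≤ Nat.log 2 n := Nat.log_pos one_lt_two hn
  have h2 : (2 : ℝ) ^ Nat.log 2 n ≤ n := by exact_mod_cast Nat.pow_log_le_self 2 (by omega)
  have h3 := Real.log_le_log (by positivity) h2
  rw [Real.log_pow] at h3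
  have h4 := Real.log_two_gt_d9
  have h5 : (1 : ℝ) ≤ Nat.log 2 n := by exact_mod_cast h1
  push_cast
  nlinarith

end Gathering

theorem theorem6p1 :
    ∃ C : ℝ, ∀ κ : Type, ∃ A : LocalAlgorithm (Finset κ) κ,
      ∀ (V : Type) [Fintype V] (G : SimpleGraph V) [DecidableRel G.Adj]
        (ident : V → ℕ) (L : V → Finset κ),
        IsIdentifierAssignment ident → IsNiceListAssignment G L →
          ∃ c : G.Coloring κ, ∀ v : V, c v ∈ L v ∧
            ∃ t : ℕ, A.Chooses G ident L v t (c v) ∧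
              (t : ℝ) ≤ C * (max G.maxDegree 1 : ℕ) ^ 2 * Real.log (Fintype.card V) ^ 3 := by
  refine ⟨2700, fun κ => ?_⟩
  rcases isEmpty_or_nonempty κ with hκ | hκ
  · -- without colors, the lists are empty, and so is the graph
    refine ⟨⟨Unit, Unit, fun _ _ _ => (), fun _ => (), fun _ _ => (), fun _ => none⟩, ?_⟩
    intro V _ G _ ident L _ hL
    have hV : IsEmpty V := ⟨fun v => by
      have h0 : (L v).card = 0 := by simp [Finset.eq_empty_of_isEmpty]
      have := hL v
      rw [h0] at this
      have := this.2 (Or.inl (by omega))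
      omega⟩
    exact ⟨SimpleGraph.Coloring.mk (fun v => hV.elim v) fun {v} => hV.elim v, fun v => hV.elim v⟩
  let m : ℕ → ℕ := fun n => Nat.log 2 n + 1
  let col : ∀ n, Network (Fin n) κ → Fin n → κ := fun n => listColor (fun x => (x : ℕ)) (m n)
  refine ⟨gather col, fun V _ G _ ident L hid hL => ?_⟩
  obtain ⟨e, he⟩ := hid.exists_equiv
  let n := Fintype.card V
  let N : Network (Fin n) κ := Network.ofEquiv e G L
  have hm : n < 2 ^ m n := Nat.lt_pow_succ_log_self one_lt_two n
  have hcol := (hL.isNice_ofEquiv e).listColor_spec (by rwa [Fintype.card_fin])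
    Fin.val_injective fun x => x.2.trans hm
  have hloc : LocalAt (col n) N (colorRadius (m n) G.maxDegree) :=
    localAt_listColor _ _ fun x => by
      obtain ⟨v, rfl⟩ := e.surjective x
      rw [degIn_ofEquiv]
      exact G.degree_le_maxDegree v
  have hadj : ∀ {u v}, G.Adj u v → col n N (e u) ≠ col n N (e v) := fun {u v} huv =>
    hcol.2 _ _ (by simpa [Network.ofEquiv] using huv)
  refine ⟨SimpleGraph.Coloring.mk (fun v => col n N (e v)) hadj, fun v => ⟨?_, ?_⟩⟩
  · have := hcol.1 (e v)
    rwa [show N.list (e v) = L v from congrArg L (e.symm_apply_apply v)] at this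
  rcases le_or_gt n 1 with hn | hn
  · -- a single vertex knows everything from the start
    have hsub : Subsingleton (Fin n) := Fin.subsingleton_iff_le_one.2 hn
    obtain ⟨t, ht, hch⟩ := exists_chooses (col := col) (G := G) (L := L) (T := 0) (v := v) he
      fun N' x h => by
        obtain rfl : e v = x := hsub.elim _ _
        refine (hloc (e v) N' fun y _ => ?_).symm
        obtain rfl : e v = y := hsub.elim _ _
        refine ⟨funext fun z => ?_, ?_⟩
        · obtain rfl : e v = z := hsub.elim _ _
          simp
        · rw [h.2.2.1]
          exact congrArg L (e.symm_apply_apply v)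
    refine ⟨t, hch, ?_⟩
    obtain rfl : t = 0 := by omega
    have := Real.log_natCast_nonneg (Fintype.card V)
    rw [Nat.cast_zero]
    positivity
  · obtain ⟨t, ht, hch⟩ := exists_chooses (col := col) (G := G) (L := L)
      (T := colorRadius (m n) G.maxDegree + 1) (v := v) he fun N' x h => by
        obtain rfl : e v = x := Fin.ext (by
          have := he v
          have := h.2.1.trans (knowledgeAt_spec _ v).2.1
          omega)
        exact (hloc (e v) N' (agree_of_consistent he h)).symm
    refine ⟨t, hch, ?_⟩
    have h1 : t ≤ 100 * (max G.maxDegree 1 ^ 2 * m n ^ 3) :=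
      ht.trans (colorRadius_succ_le (Nat.succ_le_succ (Nat.log_pos one_lt_two hn)))
    calc (t : ℝ) ≤ ((100 * (max G.maxDegree 1 ^ 2 * m n ^ 3) : ℕ) : ℝ) := by exact_mod_cast h1
      _ = 100 * ((max G.maxDegree 1 : ℕ) : ℝ) ^ 2 * ((m n : ℕ) : ℝ) ^ 3 := by push_cast; ring
      _ ≤ 100 * ((max G.maxDegree 1 : ℕ) : ℝ) ^ 2 * (3 * Real.log n) ^ 3 := by
        gcongr
        exact log_two_add_one_le hn
      _ = 2700 * ((max G.maxDegree 1 : ℕ) : ℝ) ^ 2 * Real.log (Fintype.card V) ^ 3 := by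
        simp only [n]
        ring
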